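/- \textbf{Setting.} Let $\lambda>0$ and let $\mathcal L$ be a probability measure on $\mathbb R_+=[0,\infty)$ with finite mean and distribution function $F$. Put $\mathfrak F(u):=-\int_u^\infty(1-F(x))\,dx$ (the primitive of $1-F$ that tends to $0$ at $+\infty$), and let $S\in[0,+\infty]$ be the supremum of the support of $\mathcal L$. Let $\mathrm L\subset\mathbb R\times\mathbb R_+$ be a Poisson building process of intensity $\lambda$ and height distribution $\mathcal L$: the random set of points (``buildings'') $(x_i,h_i)$, where the $x_i$ form a homogeneous Poisson point process on $\mathbb R$ of intensity $\lambda$ and the marks $h_i$ are i.i.d. of law $\mathcal L$, independent of that process. For a landscape $L'\subset\mathbb R\times\mathbb R_+$ and a point $(x,y)$, the blocking building $\tau(x,y)$ is the smallest element, for the lexicographic order, of the set of buildings $(a,b)\in L'$ with $a>x$ that maximise the slope $\frac{b-y}{a-x}$; it is undefined if there is no maximum. The zone of eventual relaying of $(a,b)\in L'$ is $$\mathrm Z(a,b)=\{(x,y)\in\mathbb R\times\mathbb R_+ : \tau^{(n)}(x,y)=(a,b)\text{ for some } n\in\mathbb N\},$$ and its length $\ell(\mathrm Z(a,b))\in[0,+\infty]$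 is the Lebesgue measure of its projection to the first coordinate. \textbf{Statement.} (1) Let $(\alpha,\beta)\in\mathbb R\times\mathbb R_+$ be a given point with $\mathcal L([\beta,+\infty))>0$, and consider the landscape $\tilde{\mathrm L}=\mathrm L\cup\{(\alpha,\beta)\}$. Then the length of the zone of eventual relaying of $(\alpha,\beta)$ in $\tilde{\mathrm L}$ is (almost everywhere) measurable, and $$\mathbb E[\ell(\mathrm Z(\alpha,\beta))]=\begin{cases}\displaystyle\int_0^\beta-\frac1\lambda\,\frac{\mathfrak F(\beta)}{\mathfrak F(u)^2}\,du<+\infty&\text{if }\beta<S,\\[2mm]+\infty&\text{if }\beta=S.\end{cases}$$ (2) Under the Palm measure of $\mathrm L$, the expected length of the zone of eventual relaying of the typical building is infinite, that is, $$\frac1\lambda\,\mathbb E\Big[\sum_{(x,h)\in\mathrm L,\ 0\le x<1}\ell\big(\mathrm Z(0,h;\ \mathrm L-(x,0))\big)\Big]=+\infty,$$ where $\mathrm Z(0,h;\mathrm L-(x,0))$ is the zone of the building $(0,h)$ in the landscape translated so that this building stands at the origin. -/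

import Mathlib

open MeasureTheory ProbabilityTheory Set

/-! ### Landscapes, blocking buildings, zones of eventual relaying -/

/-- The slope of the line through the points `p` and `q` of the plane. -/
noncomputable def blockSlope (p q : ℝ × ℝ) : ℝ := (q.2 - p.2) / (q.1 - p.1)

/-- `b` is the blocking building `τ(p)` of the point `p` in the landscape `L`: among the buildings
of `L` strictly to the right of `p` whose tops maximise the slope seen from `p`, it is the smallest
one for the lexicographic order. The blocking building is a partially defined function of `p`: it
is undefined when the slope has no maximum (see `IsBlockingBuilding.unique`). -/
def IsBlockingBuilding (L : Set (ℝ × ℝ)) (p b : ℝ × ℝ) : Prop :=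
  b ∈ L ∧ p.1 < b.1 ∧
    (∀ c ∈ L, p.1 < c.1 → blockSlope p c ≤ blockSlope p b) ∧
    ∀ c ∈ L, p.1 < c.1 → blockSlope p c = blockSlope p b → toLex b ≤ toLex c

theorem IsBlockingBuilding.unique {L : Set (ℝ × ℝ)} {p b b' : ℝ × ℝ}
    (h : IsBlockingBuilding L p b) (h' : IsBlockingBuilding L p b') : b = b' := by
  obtain ⟨hb, hpb, hmax, hmin⟩ := h
  obtain ⟨hb', hpb', hmax', hmin'⟩ := h'
  have e : blockSlope p b = blockSlope p b' := le_antisymm (hmax' b hb hpb) (hmax b' hb' hpb')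
  exact toLex.injective (le_antisymm (hmin b' hb' hpb' e.symm) (hmin' b hb hpb e))

/-- The point `p` is eventually relayed by `b`: `τ^(n)(p) = b` for some `n ∈ ℕ`. -/
def EventuallyRelayed (L : Set (ℝ × ℝ)) (p b : ℝ × ℝ) : Prop :=
  Relation.ReflTransGen (IsBlockingBuilding L) p b

/-- The zone of eventual relaying of the building `b`, a subset of the closed upper half plane. -/
def relayZone (L : Set (ℝ × ℝ)) (b : ℝ × ℝ) : Set (ℝ × ℝ) :=
  {p | 0 ≤ p.2 ∧ EventuallyRelayed L p b}

/-- The (ground) length of the zone of eventual relaying of `b`: the Lebesgue measure of its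
vertical projection. -/
noncomputable def zoneLength (L : Set (ℝ × ℝ)) (b : ℝ × ℝ) : ENNReal :=
  volume (Prod.fst '' relayZone L b)

/-! ### Poisson building processes -/

/-- The number (with multiplicity) of points of the sequence `x` in the set `B`. -/
noncomputable def pointCount (x : ℕ → ℝ) (B : Set ℝ) : ℕ∞ := {i | x i ∈ B}.encard

/-- The random sequence `X` enumerates a homogeneous Poisson point process on `ℝ` with
intensity `lam`. -/
structure IsPoissonPointProcess {Ω : Type*} [MeasurableSpace Ω] (P : Measure Ω) (lam : ℝ)
    (X : ℕ → Ω → ℝ) : Prop where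
  measurable : ∀ i, Measurable (X i)
  count_law : ∀ B : Set ℝ, MeasurableSet B → volume B < ⊤ → ∀ n : ℕ,
    P {ω | pointCount (fun i => X i ω) B = n} =
      ENNReal.ofReal (Real.exp (-(lam * volume.real B)) * (lam * volume.real B) ^ n / n.factorial)
  indep : ∀ (m : ℕ) (B : Fin m → Set ℝ), (∀ j, MeasurableSet (B j)) →
    Pairwise (fun j k => Disjoint (B j) (B k)) →
    iIndepFun (fun j ω => pointCount (fun i => X i ω) (B j)) P

/-- The random landscape `L` is a Poisson building process with intensity `lam` and height
distribution `ν`: a Poisson point process on `ℝ` whose points carry i.i.d. marks of law `ν`, which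
are independent of the point process. -/
def IsPoissonBuildingProcess {Ω : Type*} [MeasurableSpace Ω] (P : Measure Ω) (lam : ℝ)
    (ν : Measure ℝ) (L : Ω → Set (ℝ × ℝ)) : Prop :=
  ∃ X H : ℕ → Ω → ℝ,
    IsPoissonPointProcess P lam X ∧
    (∀ i, Measurable (H i)) ∧ (∀ i, P.map (H i) = ν) ∧ iIndepFun H P ∧
    IndepFun (fun ω i => X i ω) (fun ω i => H i ω) P ∧
    ∀ᵐ ω ∂P, L ω = range fun i => (X i ω, H i ω)

/-- The landscape `L` seen from the base `x`, which is moved to the origin. -/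
def shiftLandscape (x : ℝ) (L : Set (ℝ × ℝ)) : Set (ℝ × ℝ) :=
  (fun p => (p.1 - x, p.2)) '' L

/-- The expectation of `f` under the Palm probability measure of a stationary random landscape `L`
with intensity `lam`, that is
`lam⁻¹ * E [∑ f (h, L seen from x)]`, where the sum is over the buildings `(x, h) ∈ L` with
`x ∈ [0, 1)`. The arguments of `f` are the height of the typical building, which stands at the
origin, and the landscape seen from it, which contains it. -/
noncomputable def palmExpectation {Ω : Type*} [MeasurableSpace Ω] (P : Measure Ω) (lam : ℝ)
    (L : Ω → Set (ℝ × ℝ)) (f : ℝ → Set (ℝ × ℝ) → ENNReal) : ENNReal :=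
  (ENNReal.ofReal lam)⁻¹ *
    ∫⁻ ω, ∑' b : {b : ℝ × ℝ // b ∈ L ω ∧ b.1 ∈ Ico (0 : ℝ) 1},
      f b.1.2 (shiftLandscape b.1.1 (L ω)) ∂P

/-! ### Quantities attached to the height distribution -/

/-- The primitive of `1 - F` that tends to `0` at `+∞`, where `F` is the distribution function
of `ν`. -/
noncomputable def tailPrimitive (ν : Measure ℝ) (u : ℝ) : ℝ := -∫ x in Ioi u, (1 - cdf ν x)

/-- The supremum, possibly infinite, of the support of the height distribution. -/
noncomputable def heightSup (ν : Measure ℝ) : EReal := sSup ((fun x : ℝ => (x : EReal)) '' ν.support)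

/-! Following blocking buildings from a point `p` means walking along the least concave majorant of
`p` and the buildings on its right. Hence `b` is reached exactly when it is a contact point of that
majorant: every slope arriving at `b` from the left is at least every slope leaving `b` to the right
(`EventuallyRelayed.eq_or_relayCondition`, `RelayCondition.eventuallyRelayed`). Raising `p` only
lowers its slope to `b`, so the length of the zone is the measure of the set of distances `d` for
which the ground point at distance `d` on the left is relayed.

Write G for `tailIntegral`, which is minus the primitive of the statement. Let T be the inverse of
the steepest slope leaving (α, β) to the right, and U the inverse of the smallest slope arriving
from the ground point at distance d or from a building in between. The event T ≥ t says that no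
building on the right lies above the line of slope 1/t through (α, β), a region of intensity λtG(β),
so T is exponential. The event U ≤ t requires d ≤ βt and a void region on the left, of intensity
λt(G(β - d/t) - G(β)). The two regions are disjoint, so T and U are independent and P(U ≤ T) = ∫
λG(β) 1{d ≤ βt} exp(-λtG(β - d/t)) dt (`measure_sequenceRelay`). Integrating over d with u = β -
d/t, and then over t, gives (1/λ) ∫ G(β)/G(u)² du over (0, β). If no building exceeds β, every
ground point on the left is relayed and the length is infinite. The void probabilities come from the
Laplace functional of the Poisson process.

For the typical building, restrict to the event that [0, 1] contains a single building. Given this,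
its height has law ν and is independent of the other buildings, whose void probabilities away from
[0, 1] are unchanged. Treating it as if it stood at 1, and keeping only distances above 1, bounds
its zone from below, and costs at most 1 in the mean formula. It remains to see that the formula has
infinite mean under ν. This is clear if ν charges heights that are almost surely not exceeded.
Otherwise the part of the mean carried by heights above M is at least 1/2 for every M below the top
of the support (`half_le_tailMeanLength`), whereas a convergent integral would have vanishing tails
(`tailMeanLength_zero_eq_top`). -/

/-! ### The zone of eventual relaying in terms of slopes -/

/-- The building `b` lies on the least concave majorant of `p` and the buildings to the right
of `p`: seen from `b`, every building on the right has a slope at most that of the segment to `b`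
from `p`, and from every building between `p` and `b`. -/
def RelayCondition (L : Set (ℝ × ℝ)) (b p : ℝ × ℝ) : Prop :=
  p.1 < b.1 ∧ ∀ c ∈ L, b.1 < c.1 → ∀ q, q = p ∨ (q ∈ L ∧ p.1 < q.1) → q.1 < b.1 →
    (c.2 - b.2) * (b.1 - q.1) ≤ (b.2 - q.2) * (c.1 - b.1)

theorem blockSlope_le_iff {p q c : ℝ × ℝ} (hq : p.1 < q.1) (hc : p.1 < c.1) :
    blockSlope p c ≤ blockSlope p q ↔ (c.2 - p.2) * (q.1 - p.1) ≤ (q.2 - p.2) * (c.1 - p.1) :=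
  div_le_div_iff₀ (sub_pos.2 hc) (sub_pos.2 hq)

/-- Induction along the chain from its starting point. All buildings on the right of `p` lie on or
below the line through `p` and its blocking building `d`. So replacing `d` by `p`, or by a building
to the left of `d`, can only increase the slope towards `b`. -/
theorem EventuallyRelayed.eq_or_relayCondition {L : Set (ℝ × ℝ)} {p b : ℝ × ℝ} (hb : b ∈ L)
    (h : EventuallyRelayed L p b) : p = b ∨ RelayCondition L b p := by
  induction h using Relation.ReflTransGen.head_induction_on with
  | refl => exact Or.inl rfl
  | @head p d hpd _ ih =>
    obtain ⟨hd, hpd1, hmax, -⟩ := hpd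
    right
    have key : ∀ c ∈ L, p.1 < c.1 → (c.2 - p.2) * (d.1 - p.1) ≤ (d.2 - p.2) * (c.1 - p.1) :=
      fun c hc h => (blockSlope_le_iff hpd1 h).1 (hmax c hc h)
    rcases ih with rfl | ⟨hdb, hcond⟩
    · refine ⟨hpd1, fun c hc hcd q hq hqd => ?_⟩
      have h1 := key c hc (hpd1.trans hcd)
      rcases hq with rfl | ⟨hqL, hpq⟩
      · linarith
      · have h2 := key q hqL hpq
        have h3 : (d.2 - p.2) * (d.1 - q.1) ≤ (d.2 - q.2) * (d.1 - p.1) := by linarith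
        have h4 : (c.2 - d.2) * (d.1 - p.1) ≤ (d.2 - p.2) * (c.1 - d.1) := by linarith
        have h5 := mul_le_mul_of_nonneg_right h4 (sub_pos.2 hqd).le
        have h6 := mul_le_mul_of_nonneg_right h3 (sub_pos.2 hcd).le
        refine le_of_mul_le_mul_right ?_ (sub_pos.2 hpd1)
        linarith
    · refine ⟨hpd1.trans hdb, fun c hc hbc q hq hqb => ?_⟩
      have h1 := hcond c hc hbc d (Or.inl rfl) hdb
      have h2 := key b hb (hpd1.trans hdb)
      have hc0 : 0 < c.1 - b.1 := sub_pos.2 hbc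
      have hb0 : 0 < b.1 - d.1 := sub_pos.2 hdb
      -- For `q` to the left of `d`, the slope from `q` to `b` is at least the slope from `d` to
      -- `b`, which already dominates the slopes leaving `b`.
      suffices h : q.1 ≤ d.1 → (b.2 - d.2) * (b.1 - q.1) ≤ (b.2 - q.2) * (b.1 - d.1) by
        rcases le_or_gt q.1 d.1 with hqd | hqd
        · have h5 := mul_le_mul_of_nonneg_right h1 (sub_pos.2 hqb).le
          have h6 := mul_le_mul_of_nonneg_right (h hqd) hc0.le
          refine le_of_mul_le_mul_right ?_ hb0
          linarith
        · rcases hq with rfl | ⟨hqL, hpq⟩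
          · exact absurd hqd (not_lt.2 hpd1.le)
          · exact hcond c hc hbc q (Or.inr ⟨hqL, hqd⟩) hqb
      intro hqd
      rcases hq with rfl | ⟨hqL, hpq⟩
      · linarith
      · have h3 := key q hqL hpq
        -- With `m` the maximal slope seen from `p`, both `q` and `b` lie on or below the line of
        -- slope `m` through `p` and `d`. Hence the slope from `d` to `b` is at most `m`, and that
        -- from `q` to `d` at least `m`.
        obtain ⟨m, hm⟩ : ∃ m, d.2 - p.2 = m * (d.1 - p.1) :=
          ⟨(d.2 - p.2) / (d.1 - p.1), (div_mul_cancel₀ _ (sub_pos.2 hpd1).ne').symm⟩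
        have hd0 : 0 < d.1 - p.1 := sub_pos.2 hpd1
        have h4 : q.2 - p.2 ≤ m * (q.1 - p.1) := by
          refine le_of_mul_le_mul_right ?_ hd0
          rw [hm] at h3; linarith
        have h5 : b.2 - p.2 ≤ m * (b.1 - p.1) := by
          refine le_of_mul_le_mul_right ?_ hd0
          rw [hm] at h2; linarith
        have h6 : b.2 - d.2 + m * (d.1 - q.1) ≤ b.2 - q.2 := by linarith
        have h7 : b.2 - d.2 ≤ m * (b.1 - d.1) := by linarith
        have h8 := mul_le_mul_of_nonneg_right h6 hb0.le
        have h9 := mul_le_mul_of_nonneg_right h7 (sub_nonneg.2 hqd)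
        linarith

/-- Induction on the number of buildings in the window from `p` (excluded) to `b`. The condition
prevents buildings beyond `b` from beating `b`, so the slope has a maximum, attained in this finite
window. The blocking building inherits the condition and has a smaller window. -/
theorem RelayCondition.eventuallyRelayed {L : Set (ℝ × ℝ)} {b : ℝ × ℝ} (hb : b ∈ L)
    (huniq : ∀ c ∈ L, c.1 = b.1 → c = b) {p : ℝ × ℝ}
    (hfin : {q ∈ L | p.1 < q.1 ∧ q.1 ≤ b.1}.Finite)
    (h : RelayCondition L b p) : EventuallyRelayed L p b := by
  induction hn : {q ∈ L | p.1 < q.1 ∧ q.1 ≤ b.1}.ncard using Nat.strong_induction_on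
    generalizing p with
  | _ n ih =>
  obtain ⟨hpb, hcond⟩ := h
  obtain ⟨d0, hd0, hmax0⟩ := hfin.exists_maximalFor (blockSlope p) _
    ⟨b, (⟨hb, hpb, le_rfl⟩ : b ∈ L ∧ p.1 < b.1 ∧ b.1 ≤ b.1)⟩
  have hmax0 : ∀ c ∈ {q ∈ L | p.1 < q.1 ∧ q.1 ≤ b.1}, blockSlope p c ≤ blockSlope p d0 := by
    intro c hc
    by_contra! hlt
    exact absurd (hmax0 hc hlt.le) (not_le.2 hlt)
  have hfin' : {q ∈ {q ∈ L | p.1 < q.1 ∧ q.1 ≤ b.1} | blockSlope p q = blockSlope p d0}.Finite :=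
    hfin.subset (sep_subset _ _)
  obtain ⟨d, ⟨⟨hdL, hpd, hdb⟩, hds⟩, hmin⟩ := hfin'.exists_minimalFor toLex _
    (show {q ∈ {q ∈ L | p.1 < q.1 ∧ q.1 ≤ b.1} | blockSlope p q = blockSlope p d0}.Nonempty from
      ⟨d0, hd0, rfl⟩)
  have hfar : ∀ c ∈ L, b.1 < c.1 → blockSlope p c ≤ blockSlope p d := by
    intro c hc hbc
    rw [hds]
    refine le_trans ?_ (hmax0 b ⟨hb, hpb, le_rfl⟩)
    rw [blockSlope_le_iff hpb (hpb.trans hbc)]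
    linarith [hcond c hc hbc p (Or.inl rfl) hpb]
  have hstep : IsBlockingBuilding L p d := by
    refine ⟨hdL, hpd, fun c hc hpc => ?_, fun c hc hpc he => ?_⟩
    · rcases le_or_gt c.1 b.1 with hcb | hcb
      · exact hds ▸ hmax0 c ⟨hc, hpc, hcb⟩
      · exact hfar c hc hcb
    -- A tie with a building beyond `b` is harmless, since the lexicographic order prefers the
    -- smaller abscissa.
    · rcases le_or_gt c.1 b.1 with hcb | hcb
      · rcases le_total (toLex d) (toLex c) with hle | hle
        · exact hle
        · exact hmin ⟨⟨hc, hpc, hcb⟩, he.trans hds⟩ hle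
      · exact Prod.Lex.toLex_le_toLex.2 (Or.inl (hdb.trans_lt hcb))
  rcases hdb.lt_or_eq with hlt | heq
  · refine Relation.ReflTransGen.head hstep ?_
    have hss : {q ∈ L | d.1 < q.1 ∧ q.1 ≤ b.1} ⊂ {q ∈ L | p.1 < q.1 ∧ q.1 ≤ b.1} := by
      have hsub : {q ∈ L | d.1 < q.1 ∧ q.1 ≤ b.1} ⊆ {q ∈ L | p.1 < q.1 ∧ q.1 ≤ b.1} :=
        fun q hq => ⟨hq.1, hpd.trans hq.2.1, hq.2.2⟩
      exact (ssubset_iff_of_subset hsub).2 ⟨d, ⟨hdL, hpd, hdb⟩, fun hd => lt_irrefl _ hd.2.1⟩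
    refine ih _ (hn ▸ ncard_lt_ncard hss hfin) (hfin.subset hss.subset) ⟨hlt, ?_⟩ rfl
    rintro c hc hbc q (rfl | ⟨hq, hdq⟩) hqb
    · exact hcond c hc hbc q (Or.inr ⟨hdL, hpd⟩) hqb
    · exact hcond c hc hbc q (Or.inr ⟨hq, hpd.trans hdq⟩) hqb
  · rw [huniq d hdL heq] at hstep
    exact Relation.ReflTransGen.single hstep

/-- Lowering a point to the ground raises its slope towards `b` and leaves the other constraints
unchanged, so a vertical line meets the zone exactly when its ground point is relayed; the line
through `b` itself is the exception. -/
theorem fst_image_relayZone {L : Set (ℝ × ℝ)} {b : ℝ × ℝ} (hb : b ∈ L) (hb0 : 0 ≤ b.2)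
    (huniq : ∀ c ∈ L, c.1 = b.1 → c = b)
    (hfin : ∀ z, {q ∈ L | z < q.1 ∧ q.1 ≤ b.1}.Finite) :
    Prod.fst '' relayZone L b = insert b.1 {z | RelayCondition L b (z, 0)} := by
  ext z
  constructor
  · rintro ⟨p, ⟨hp0, hp⟩, rfl⟩
    rcases hp.eq_or_relayCondition hb with rfl | ⟨hpb, hcond⟩
    · exact mem_insert _ _
    · refine mem_insert_of_mem _ ⟨hpb, ?_⟩
      rintro c hc hbc q (rfl | hq) hqb
      · refine (hcond c hc hbc p (Or.inl rfl) hpb).trans ?_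
        exact mul_le_mul_of_nonneg_right (by simpa using hp0) (sub_pos.2 hbc).le
      · exact hcond c hc hbc q (Or.inr hq) hqb
  · rintro (rfl | h)
    · exact ⟨b, ⟨hb0, Relation.ReflTransGen.refl⟩, rfl⟩
    · exact ⟨(z, 0), ⟨le_rfl, RelayCondition.eventuallyRelayed hb huniq (hfin z) h⟩, rfl⟩

theorem zoneLength_eq {L : Set (ℝ × ℝ)} {b : ℝ × ℝ} (hb : b ∈ L) (hb0 : 0 ≤ b.2)
    (huniq : ∀ c ∈ L, c.1 = b.1 → c = b)
    (hfin : ∀ z, {q ∈ L | z < q.1 ∧ q.1 ≤ b.1}.Finite) :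
    zoneLength L b = volume {d | RelayCondition L b (b.1 - d, 0)} := by
  rw [zoneLength, fst_image_relayZone hb hb0 huniq hfin,
    measure_congr (insert_ae_eq_self _ _)]
  have h := (Measure.measurePreserving_sub_left volume b.1).measure_preimage_equiv
    (f := MeasurableEquiv.subLeft b.1) {z | RelayCondition L b (z, 0)}
  exact h.symm

/-! ### The function `exp (-t)` on `[0, ∞]` -/

/-- The decreasing function `exp (-t)` of `t ∈ [0, ∞]`. -/
noncomputable def expNeg (t : ENNReal) : ENNReal := EReal.exp (-(t : EReal))

/-- The inverse of `expNeg`, on `[0, 1]`. -/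
noncomputable def negLog (q : ENNReal) : ENNReal := (-(ENNReal.log q)).toENNReal

@[simp] theorem expNeg_zero : expNeg 0 = 1 := by simp [expNeg]

@[simp] theorem expNeg_top : expNeg ⊤ = 0 := by simp [expNeg]

theorem expNeg_add (s t : ENNReal) : expNeg (s + t) = expNeg s * expNeg t := by
  rw [expNeg, expNeg, expNeg, ← EReal.exp_add, EReal.coe_ennreal_add,
    EReal.neg_add (Or.inl (EReal.coe_ennreal_ne_bot _)) (Or.inr (EReal.coe_ennreal_ne_bot _)),
    sub_eq_add_neg]

theorem expNeg_sum {ι : Type*} (s : Finset ι) (f : ι → ENNReal) :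
    expNeg (∑ i ∈ s, f i) = ∏ i ∈ s, expNeg (f i) := by
  classical
  induction s using Finset.induction_on with
  | empty => simp
  | insert i s hi ih => rw [Finset.sum_insert hi, Finset.prod_insert hi, expNeg_add, ih]

theorem continuous_expNeg : Continuous expNeg :=
  ENNReal.continuous_exp.comp (continuous_neg.comp continuous_coe_ennreal_ereal)

theorem measurable_expNeg : Measurable expNeg := continuous_expNeg.measurable

theorem antitone_expNeg : Antitone expNeg := fun _ _ h =>
  EReal.exp_monotone (EReal.neg_le_neg_iff.2 (EReal.coe_ennreal_le_coe_ennreal_iff.2 h))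

theorem expNeg_le_one (t : ENNReal) : expNeg t ≤ 1 :=
  (antitone_expNeg (zero_le : 0 ≤ t)).trans_eq expNeg_zero

theorem expNeg_ofReal {x : ℝ} (hx : 0 ≤ x) :
    expNeg (ENNReal.ofReal x) = ENNReal.ofReal (Real.exp (-x)) := by
  rw [expNeg, EReal.coe_ennreal_ofReal, max_eq_left hx, ← EReal.coe_neg, EReal.exp_coe]

theorem expNeg_negLog {q : ENNReal} (hq : q ≤ 1) : expNeg (negLog q) = q := by
  have h : 0 ≤ -(ENNReal.log q) := EReal.neg_nonneg.2 (ENNReal.log_le_zero_iff.2 hq)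
  rw [expNeg, negLog, EReal.coe_toENNReal h, neg_neg, ENNReal.exp_log]

@[simp] theorem negLog_one : negLog 1 = 0 := by simp [negLog]

theorem measurable_negLog : Measurable negLog :=
  (ENNReal.measurable_log.neg).ereal_toENNReal

theorem tendsto_prod_expNeg (f : ℕ → ENNReal) :
    Filter.Tendsto (fun m => ∏ i ∈ Finset.range m, expNeg (f i)) Filter.atTop
      (nhds (expNeg (∑' i, f i))) := by
  simp only [← expNeg_sum]
  exact (continuous_expNeg.tendsto _).comp (ENNReal.tendsto_nat_tsum f)

theorem expNeg_mul_natCast (a : ENNReal) (n : ℕ) : expNeg (a * n) = expNeg a ^ n := by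
  induction n with
  | zero => simp
  | succ n ih => rw [Nat.cast_succ, mul_add, mul_one, expNeg_add, ih, pow_succ]

/-! ### Laplace functional of a Poisson point process -/

theorem tsum_indicator_eq_pointCount (x : ℕ → ℝ) (B : Set ℝ) :
    ∑' i, B.indicator 1 (x i) = (pointCount x B : ENNReal) := by
  rw [pointCount, ← ENNReal.tsum_set_one, tsum_subtype {i | x i ∈ B} (fun _ => (1 : ENNReal))]
  rfl

section PointProcess

variable {Ω : Type*} [MeasurableSpace Ω] {P : Measure Ω} [IsProbabilityMeasure P] {lam : ℝ}
  {X : ℕ → Ω → ℝ}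

theorem measurable_pointCount (hX : ∀ i, Measurable (X i)) {B : Set ℝ} (hB : MeasurableSet B) :
    Measurable fun ω => pointCount (fun i => X i ω) B := by
  refine measurable_to_countable' fun n => ?_
  have h : Measurable fun ω => ∑' i, B.indicator (1 : ℝ → ENNReal) (X i ω) :=
    Measurable.tsum fun i => (measurable_one.indicator hB).comp (hX i)
  convert h (measurableSet_singleton (n : ENNReal)) using 1
  ext ω
  simp [tsum_indicator_eq_pointCount (fun i => X i ω)]

/-- The probability generating function of the Poisson law of mean `v`, evaluated at `c`. -/
theorem hasSum_poisson {v : ℝ} (c : ℝ) :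
    HasSum (fun n : ℕ => c ^ n * (Real.exp (-v) * v ^ n / n.factorial))
      (Real.exp (-(v * (1 - c)))) := by
  have h := (NormedSpace.expSeries_div_hasSum_exp (c * v)).mul_left (Real.exp (-v))
  rw [← Real.exp_eq_exp_ℝ, ← Real.exp_add] at h
  rw [show -(v * (1 - c)) = -v + c * v by ring]
  have e : ∀ n : ℕ, c ^ n * (Real.exp (-v) * v ^ n / n.factorial) =
      Real.exp (-v) * ((c * v) ^ n / n.factorial) := fun n => by rw [mul_pow]; ring
  simpa only [e] using h

theorem IsPoissonPointProcess.ae_pointCount_ne_top (hX : IsPoissonPointProcess P lam X)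
    (hlam : 0 < lam) {B : Set ℝ} (hB : MeasurableSet B) (hv : volume B < ⊤) :
    ∀ᵐ ω ∂P, pointCount (fun i => X i ω) B ≠ ⊤ := by
  have hm := measurable_pointCount hX.measurable hB
  have hv0 : 0 ≤ lam * volume.real B := mul_nonneg hlam.le measureReal_nonneg
  have h1 : P (⋃ n : ℕ, {ω | pointCount (fun i => X i ω) B = n}) = 1 := by
    rw [measure_iUnion]
    · simp only [hX.count_law B hB hv]
      have h := hasSum_poisson (v := lam * volume.real B) 1
      rw [← ENNReal.ofReal_tsum_of_nonneg]
      · simpa using congrArg ENNReal.ofReal h.tsum_eq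
      · intro n; positivity
      · simpa using h.summable
    · intro m n hmn
      refine Set.disjoint_left.2 fun ω h1 h2 => hmn ?_
      have h3 : (m : ℕ∞) = n := h1.symm.trans h2
      exact_mod_cast h3
    · exact fun n => hm (measurableSet_singleton _)
  have h2 : ∀ᵐ ω ∂P, ω ∈ ⋃ n : ℕ, {ω | pointCount (fun i => X i ω) B = n} :=
    (mem_ae_iff_prob_eq_one (MeasurableSet.iUnion fun n => hm (measurableSet_singleton _))).2 h1
  filter_upwards [h2] with ω hω
  obtain ⟨n, hn⟩ := mem_iUnion.1 hω
  have hn : pointCount (fun i => X i ω) B = n := hn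
  rw [hn]
  exact ENat.natCast_ne_top n

theorem IsPoissonPointProcess.lintegral_expNeg_mul_pointCount
    (hX : IsPoissonPointProcess P lam X) (hlam : 0 < lam) {B : Set ℝ} (hB : MeasurableSet B)
    (hv : volume B < ⊤) (a : ENNReal) :
    ∫⁻ ω, expNeg (a * (pointCount (fun i => X i ω) B : ENNReal)) ∂P =
      expNeg (ENNReal.ofReal lam * ((1 - expNeg a) * volume B)) := by
  have hm := measurable_pointCount hX.measurable hB
  have hv0 : 0 ≤ lam * volume.real B := mul_nonneg hlam.le measureReal_nonneg
  obtain ⟨c, hc⟩ : ∃ c : ℝ, c = (expNeg a).toReal := ⟨_, rfl⟩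
  have hcne : expNeg a ≠ ⊤ := ((expNeg_le_one a).trans_lt ENNReal.one_lt_top).ne
  have hca : expNeg a = ENNReal.ofReal c := by rw [hc, ENNReal.ofReal_toReal hcne]
  have hc0 : 0 ≤ c := hc ▸ ENNReal.toReal_nonneg
  have hc1 : c ≤ 1 := by
    rw [hc]; exact ENNReal.toReal_le_of_le_ofReal zero_le_one (by simpa using expNeg_le_one a)
  have h1 : ∫⁻ ω, expNeg (a * (pointCount (fun i => X i ω) B : ENNReal)) ∂P =
      ∫⁻ ω, ∑' n : ℕ, ENNReal.ofReal (c ^ n) *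
        {ω | pointCount (fun i => X i ω) B = n}.indicator 1 ω ∂P := by
    refine lintegral_congr_ae ?_
    filter_upwards [hX.ae_pointCount_ne_top hlam hB hv] with ω hω
    obtain ⟨n, hn⟩ := ENat.ne_top_iff_exists.1 hω
    rw [tsum_eq_single n]
    · simp only [← hn, ENat.toENNReal_coe, expNeg_mul_natCast, hca]
      rw [indicator_of_mem (by simp [hn]), Pi.one_apply, mul_one, ENNReal.ofReal_pow hc0]
    · intro m hmn
      rw [indicator_of_notMem, mul_zero]
      intro h
      have h : pointCount (fun i => X i ω) B = m := h
      rw [← hn] at h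
      exact hmn (by exact_mod_cast h.symm)
  have hms : ∀ n : ℕ, MeasurableSet {ω | pointCount (fun i => X i ω) B = n} :=
    fun n => hm (measurableSet_singleton _)
  rw [h1, lintegral_tsum fun n => ((measurable_one.indicator (hms n)).const_mul _).aemeasurable]
  have h2 := hasSum_poisson (v := lam * volume.real B) c
  have h3 : ∀ n : ℕ, ∫⁻ ω, ENNReal.ofReal (c ^ n) *
      {ω | pointCount (fun i => X i ω) B = n}.indicator 1 ω ∂P = ENNReal.ofReal
        (c ^ n * (Real.exp (-(lam * volume.real B)) * (lam * volume.real B) ^ n / n.factorial)) := by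
    intro n
    rw [lintegral_const_mul _ (measurable_one.indicator (hms n)), lintegral_indicator_one (hms n),
      hX.count_law B hB hv, ENNReal.ofReal_mul (pow_nonneg hc0 n)]
  simp only [h3]
  rw [← ENNReal.ofReal_tsum_of_nonneg (fun n => by positivity) h2.summable, h2.tsum_eq,
    ← expNeg_ofReal (mul_nonneg hv0 (sub_nonneg.2 hc1)), hca, ← ENNReal.ofReal_one,
    ← ENNReal.ofReal_sub _ hc0, ← ENNReal.ofReal_toReal hv.ne,
    ← ENNReal.ofReal_mul (sub_nonneg.2 hc1), ← ENNReal.ofReal_mul hlam.le]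
  congr 2
  rw [Measure.real]; ring

/-- Decomposition over level sets. The value 0 is left out because its level set may have infinite
measure; `h 0 = 0` makes this harmless. -/
theorem SimpleFunc.comp_eq_sum (f : SimpleFunc ℝ ENNReal) (h : ENNReal → ENNReal) (h0 : h 0 = 0)
    (x : ℝ) : h (f x) = ∑ c : {c // c ∈ f.range.erase 0}, h c * (f ⁻¹' {c.1}).indicator 1 x := by
  rw [Finset.sum_coe_sort (f.range.erase 0) fun c => h c * (f ⁻¹' {c}).indicator 1 x]
  by_cases hx : f x = 0
  · rw [hx, h0, Finset.sum_eq_zero]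
    intro c hc
    rw [indicator_of_notMem, mul_zero]
    rintro rfl
    exact (Finset.mem_erase.1 hc).1 hx
  · rw [Finset.sum_eq_single (f x)]
    · rw [indicator_of_mem (by simp), Pi.one_apply, mul_one]
    · intro c _ hc
      rw [indicator_of_notMem, mul_zero]
      exact fun h => hc (Eq.symm h)
    · intro h
      exact absurd (Finset.mem_erase.2 ⟨hx, f.mem_range_self x⟩) h

/-- The nonzero level sets of `f` and the set `I` are pairwise disjoint, so their counts are
independent and the expectation factorises. In the index type `Option ι`, `none` stands for `I` and
`some c` for the level set of `c`. -/
theorem IsPoissonPointProcess.lintegral_expNeg_simpleFunc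
    (hX : IsPoissonPointProcess P lam X) (hlam : 0 < lam) {I : Set ℝ} (hI : MeasurableSet I)
    (k : ℕ) (f : SimpleFunc ℝ ENNReal) (hfI : ∀ x ∈ I, f x = 0)
    (hf : volume (Function.support f) < ⊤) :
    ∫⁻ ω, {ω | pointCount (fun i => X i ω) I = k}.indicator 1 ω * expNeg (∑' i, f (X i ω)) ∂P =
      P {ω | pointCount (fun i => X i ω) I = k} *
        expNeg (ENNReal.ofReal lam * ∫⁻ x, (1 - expNeg (f x))) := by
  let ι := {c // c ∈ f.range.erase 0}
  let B : Option ι → Set ℝ := fun o => o.elim I fun c => f ⁻¹' {c.1}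
  have hB : ∀ o, MeasurableSet (B o) := by
    rintro (_ | c)
    · exact hI
    · exact f.measurableSet_fiber _
  have hBv : ∀ c : ι, volume (f ⁻¹' {c.1}) < ⊤ := by
    intro c
    refine (measure_mono fun x hx => ?_).trans_lt hf
    have hx : f x = c.1 := hx
    rw [Function.mem_support, hx]
    exact (Finset.mem_erase.1 c.2).1
  have hdisj : Pairwise fun o o' => Disjoint (B o) (B o') := by
    have hnone : ∀ c : ι, Disjoint I (f ⁻¹' {c.1}) := fun c =>
      Set.disjoint_left.2 fun x hx hxc =>
        (Finset.mem_erase.1 c.2).1 ((Eq.symm hxc).trans (hfI x hx))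
    rintro (_ | c) (_ | c') hne
    · exact absurd rfl hne
    · exact hnone c'
    · exact (hnone c).symm
    · refine Set.disjoint_left.2 fun x hx hx' => hne ?_
      exact congrArg some (Subtype.ext (Eq.trans (Eq.symm hx) hx'))
  let e := Fintype.equivFin (Option ι)
  have hind : iIndepFun (fun o ω => pointCount (fun i => X i ω) (B o)) P := by
    have h := (hX.indep _ (fun j => B (e.symm j)) (fun j => hB _)
      fun i j hij => hdisj (e.symm.injective.ne hij)).precomp e.injective
    simpa using h
  let φ : Option ι → ℕ∞ → ENNReal :=
    fun o => o.elim (({(k : ℕ∞)} : Set ℕ∞).indicator 1) fun c n => expNeg (c.1 * (n : ENNReal))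
  have hφ : ∀ o, Measurable (φ o) := fun o => measurable_from_top
  have hprod := lintegral_prod_eq_prod_lintegral_of_indepFun Finset.univ _ (hind.comp φ hφ)
    fun o => (hφ o).comp (measurable_pointCount hX.measurable (hB o))
  rw [Fintype.prod_option, lintegral_congr fun ω => Fintype.prod_option _] at hprod
  have e1 : ∀ ω, ∏ c : ι, (φ (some c) ∘ fun ω => pointCount (fun i => X i ω) (B (some c))) ω =
      expNeg (∑' i, f (X i ω)) := by
    intro ω
    have hs : ∀ i, f (X i ω) = ∑ c : ι, c.1 * (f ⁻¹' {c.1}).indicator 1 (X i ω) :=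
      fun i => SimpleFunc.comp_eq_sum f id rfl (X i ω)
    rw [tsum_congr hs, Summable.tsum_finsetSum fun _ _ => ENNReal.summable, expNeg_sum]
    refine Finset.prod_congr rfl fun c _ => ?_
    rw [ENNReal.tsum_mul_left, tsum_indicator_eq_pointCount (fun i => X i ω)]
    rfl
  simp only [e1] at hprod
  refine Eq.trans ?_ (hprod.trans ?_)
  · rfl
  · congr 1
    · exact lintegral_indicator_one
        (measurable_pointCount hX.measurable hI (measurableSet_singleton _))
    · have h1 : ∀ c : ι, ∫⁻ ω, (φ (some c) ∘ fun ω => pointCount (fun i => X i ω) (B (some c))) ω ∂P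
          = expNeg (ENNReal.ofReal lam * ((1 - expNeg c) * volume (f ⁻¹' {c.1}))) := fun c =>
        hX.lintegral_expNeg_mul_pointCount hlam (hB (some c)) (hBv c) c
      rw [Finset.prod_congr rfl fun c _ => h1 c, ← expNeg_sum, ← Finset.mul_sum]
      congr 2
      simp only [fun x => SimpleFunc.comp_eq_sum f (fun t => 1 - expNeg t) (by simp) x]
      rw [lintegral_finsetSum]
      · refine Finset.sum_congr rfl fun c _ => ?_
        rw [lintegral_const_mul _ (measurable_one.indicator (f.measurableSet_fiber _)),
          lintegral_indicator_one (f.measurableSet_fiber _)]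
      · exact fun c _ => (measurable_one.indicator (f.measurableSet_fiber _)).const_mul _

end PointProcess

/-! ### Laplace functional for general functions, and void probabilities of the marked process. -/

section BuildingProcess

variable {Ω : Type*} [MeasurableSpace Ω] {P : Measure Ω} [IsProbabilityMeasure P] {lam : ℝ}
  {X H : ℕ → Ω → ℝ} {ν : Measure ℝ}

theorem measurableSet_pointCount_eq {I : Set ℝ} (hI : MeasurableSet I) (k : ℕ) :
    MeasurableSet {x : ℕ → ℝ | pointCount x I = k} :=
  measurable_pointCount (X := fun i (x : ℕ → ℝ) => x i) (fun i => measurable_pi_apply i) hI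
    (measurableSet_singleton _)

theorem IsPoissonPointProcess.lintegral_expNeg_tsum
    (hX : IsPoissonPointProcess P lam X) (hlam : 0 < lam) {I : Set ℝ} (hI : MeasurableSet I)
    (k : ℕ) {f : ℝ → ENNReal} (hf : Measurable f) (hfI : ∀ x ∈ I, f x = 0) :
    ∫⁻ ω, {ω | pointCount (fun i => X i ω) I = k}.indicator 1 ω * expNeg (∑' i, f (X i ω)) ∂P =
      P {ω | pointCount (fun i => X i ω) I = k} *
        expNeg (ENNReal.ofReal lam * ∫⁻ x, (1 - expNeg (f x))) := by
  have hIcc : ∀ n : ℕ, MeasurableSet (Icc (-(n : ℝ)) n) := fun n => measurableSet_Icc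
  -- Truncation to [-n, n] gives the approximating simple functions supports of finite measure; they
  -- still increase to `f`.
  let F : ℕ → SimpleFunc ℝ ENNReal := fun n =>
    (SimpleFunc.eapprox f n).restrict (Icc (-(n : ℝ)) n)
  have hF : ∀ n x, F n x = (Icc (-(n : ℝ)) n).indicator (SimpleFunc.eapprox f n) x := fun n x =>
    SimpleFunc.restrict_apply _ (hIcc n) x
  have hle : ∀ n x, SimpleFunc.eapprox f n x ≤ f x := fun n x => by
    rw [← SimpleFunc.iSup_eapprox_apply hf x]
    exact le_iSup (fun n => SimpleFunc.eapprox f n x) n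
  have hFmono : ∀ x, Monotone fun n => F n x := by
    intro x m n hmn
    simp only [hF]
    refine (indicator_le_indicator (SimpleFunc.monotone_eapprox f hmn x)).trans
      (indicator_le_indicator_of_subset ?_ (fun _ => zero_le) x)
    have : (m : ℝ) ≤ n := by exact_mod_cast hmn
    exact Icc_subset_Icc (neg_le_neg this) this
  have hFlim : ∀ x, Filter.Tendsto (fun n => F n x) Filter.atTop (nhds (f x)) := by
    intro x
    have h := tendsto_atTop_iSup fun m n (hmn : m ≤ n) => SimpleFunc.monotone_eapprox f hmn x
    rw [SimpleFunc.iSup_eapprox_apply hf x] at h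
    refine h.congr' ?_
    obtain ⟨N, hN⟩ := exists_nat_ge |x|
    filter_upwards [Filter.eventually_ge_atTop N] with n hn
    rw [hF, indicator_of_mem]
    exact abs_le.1 (hN.trans (by exact_mod_cast hn))
  have hC : MeasurableSet {ω | pointCount (fun i => X i ω) I = k} :=
    measurable_pointCount hX.measurable hI (measurableSet_singleton _)
  have h1 : ∀ n, ∫⁻ ω, {ω | pointCount (fun i => X i ω) I = k}.indicator 1 ω *
      expNeg (∑' i, F n (X i ω)) ∂P = P {ω | pointCount (fun i => X i ω) I = k} *
        expNeg (ENNReal.ofReal lam * ∫⁻ x, (1 - expNeg (F n x))) := by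
    intro n
    refine hX.lintegral_expNeg_simpleFunc hlam hI k (F n) (fun x hx => ?_) ?_
    · rw [hF]
      refine le_antisymm ((indicator_le_self _ _ x).trans ((hle n x).trans_eq (hfI x hx))) zero_le
    · refine (measure_mono (t := Icc (-(n : ℝ)) n) fun x hx => ?_).trans_lt (by simp)
      by_contra h
      exact hx (by rw [hF, indicator_of_notMem h])
  have hsum : ∀ ω, Filter.Tendsto (fun n => ∑' i, F n (X i ω)) Filter.atTop
      (nhds (∑' i, f (X i ω))) := by
    intro ω
    have := lintegral_tendsto_of_tendsto_of_monotone (μ := Measure.count)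
      (f := fun n i => F n (X i ω)) (F := fun i => f (X i ω))
      (fun n => measurable_from_top.aemeasurable) (ae_of_all _ fun i => hFmono _)
      (ae_of_all _ fun i => hFlim _)
    simpa only [lintegral_count] using this
  have hmS : ∀ g : ℝ → ENNReal, Measurable g → Measurable fun ω => ∑' i, g (X i ω) :=
    fun g hg => Measurable.tsum fun i => hg.comp (hX.measurable i)
  have hlim1 : Filter.Tendsto (fun n => ∫⁻ ω, {ω | pointCount (fun i => X i ω) I = k}.indicator 1 ω *
      expNeg (∑' i, F n (X i ω)) ∂P) Filter.atTop (nhds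
      (∫⁻ ω, {ω | pointCount (fun i => X i ω) I = k}.indicator 1 ω *
        expNeg (∑' i, f (X i ω)) ∂P)) := by
    refine tendsto_lintegral_of_dominated_convergence (fun _ => 1)
      (fun n => (measurable_one.indicator hC).mul (measurable_expNeg.comp (hmS _ (F n).measurable)))
      (fun n => ae_of_all _ fun ω => ?_) (by simp) (ae_of_all _ fun ω => ?_)
    · exact mul_le_one' (indicator_le_self' (fun _ _ => zero_le) ω) (expNeg_le_one _)
    · refine ENNReal.Tendsto.const_mul ((continuous_expNeg.tendsto _).comp (hsum ω)) (Or.inr ?_)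
      exact ((indicator_le_self' (fun _ _ => zero_le) ω).trans_lt ENNReal.one_lt_top).ne
  have hlim2 : Filter.Tendsto (fun n => P {ω | pointCount (fun i => X i ω) I = k} *
      expNeg (ENNReal.ofReal lam * ∫⁻ x, (1 - expNeg (F n x)))) Filter.atTop (nhds
      (P {ω | pointCount (fun i => X i ω) I = k} *
        expNeg (ENNReal.ofReal lam * ∫⁻ x, (1 - expNeg (f x))))) := by
    refine ENNReal.Tendsto.const_mul ((continuous_expNeg.tendsto _).comp ?_)
      (Or.inr (measure_ne_top _ _))
    refine ENNReal.Tendsto.const_mul ?_ (Or.inr ENNReal.ofReal_ne_top)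
    refine lintegral_tendsto_of_tendsto_of_monotone
      (fun n => (measurable_const.sub (measurable_expNeg.comp (F n).measurable)).aemeasurable)
      (ae_of_all _ fun x m n hmn => tsub_le_tsub_left (antitone_expNeg (hFmono x hmn)) _)
      (ae_of_all _ fun x => ?_)
    exact ENNReal.Tendsto.sub tendsto_const_nhds ((continuous_expNeg.tendsto _).comp (hFlim x))
      (Or.inl ENNReal.one_ne_top)
  simp only [h1] at hlim1
  exact tendsto_nhds_unique hlim1 hlim2

/-- The probability is an infinite product. Written as the exponential of a sum, with the value ⊤
allowed when a factor vanishes, it fits the Laplace functional. -/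
theorem measure_forall_mem_of_iIndepFun (hH : ∀ i, Measurable (H i)) (hν : ∀ i, P.map (H i) = ν)
    (hHi : iIndepFun H P) {B : ℕ → Set ℝ} (hB : ∀ i, MeasurableSet (B i)) :
    P {ω | ∀ i, H i ω ∈ B i} = expNeg (∑' i, negLog (ν (B i))) := by
  have hms : ∀ i, MeasurableSet (H i ⁻¹' B i) := fun i => hH i (hB i)
  have hνB : ∀ i, P (H i ⁻¹' B i) = ν (B i) := fun i => by
    rw [← hν i, Measure.map_apply (hH i) (hB i)]
  have h1 : ∀ m : ℕ, P (⋂ i ∈ Finset.range m, H i ⁻¹' B i) =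
      ∏ i ∈ Finset.range m, expNeg (negLog (ν (B i))) := by
    intro m
    rw [hHi.meas_biInter fun i _ => ⟨B i, hB i, rfl⟩]
    refine Finset.prod_congr rfl fun i _ => ?_
    rw [expNeg_negLog (hνB i ▸ prob_le_one), hνB i]
  have h2 := tendsto_prod_expNeg fun i => negLog (ν (B i))
  simp only [← h1] at h2
  have h3 := tendsto_measure_iInter_atTop (μ := P)
    (s := fun m : ℕ => ⋂ i ∈ Finset.range m, H i ⁻¹' B i)
    (fun m => (Finset.measurableSet_biInter _ fun i _ => hms i).nullMeasurableSet)
    (fun m n hmn => biInter_subset_biInter_left (Finset.range_mono hmn))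
    ⟨0, measure_ne_top _ _⟩
  rw [← tendsto_nhds_unique h3 h2]
  congr 1
  ext ω
  simp only [mem_ofPred_eq, mem_iInter, Finset.mem_range, mem_preimage]
  exact ⟨fun h _ i _ => h i, fun h i => h (i + 1) i (Nat.lt_succ_self i)⟩

theorem map_sequences_eq_prod (hX : ∀ i, Measurable (X i)) (hH : ∀ i, Measurable (H i))
    (hXH : IndepFun (fun ω i => X i ω) (fun ω i => H i ω) P) :
    P.map (fun ω => ((fun i => X i ω), fun i => H i ω)) =
      (P.map fun ω i => X i ω).prod (P.map fun ω i => H i ω) :=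
  (indepFun_iff_map_prod_eq_prod_map_map (measurable_pi_lambda _ hX).aemeasurable
    (measurable_pi_lambda _ hH).aemeasurable).1 hXH

/-- Void probabilities of a Poisson building process, given the number of its points in a part of
the line. -/
theorem IsPoissonPointProcess.measure_inter_forall_notMem
    (hX : IsPoissonPointProcess P lam X) (hlam : 0 < lam) (hH : ∀ i, Measurable (H i))
    (hν : ∀ i, P.map (H i) = ν) (hHi : iIndepFun H P)
    (hXH : IndepFun (fun ω i => X i ω) (fun ω i => H i ω) P)
    {I : Set ℝ} (hI : MeasurableSet I) (k : ℕ) {A : Set (ℝ × ℝ)} (hA : MeasurableSet A)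
    (hAI : ∀ p ∈ A, p.1 ∉ I) :
    P ({ω | pointCount (fun i => X i ω) I = k} ∩ {ω | ∀ i, (X i ω, H i ω) ∉ A}) =
      P {ω | pointCount (fun i => X i ω) I = k} *
        expNeg (ENNReal.ofReal lam * (volume.prod ν) A) := by
  have : IsProbabilityMeasure ν := hν 0 ▸ Measure.isProbabilityMeasure_map (hH 0).aemeasurable
  have hXm : Measurable fun ω i => X i ω := measurable_pi_lambda _ hX.measurable
  have hHm : Measurable fun ω i => H i ω := measurable_pi_lambda _ hH
  have hPH : IsProbabilityMeasure (P.map fun ω i => H i ω) :=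
    Measure.isProbabilityMeasure_map hHm.aemeasurable
  set C : Set (ℕ → ℝ) := {x | pointCount x I = k}
  have hC : MeasurableSet C := measurableSet_pointCount_eq hI k
  have hS : MeasurableSet {p : (ℕ → ℝ) × (ℕ → ℝ) | p.1 ∈ C ∧ ∀ i, (p.1 i, p.2 i) ∉ A} := by
    have h : ∀ i, Measurable fun p : (ℕ → ℝ) × (ℕ → ℝ) => (p.1 i, p.2 i) := by fun_prop
    convert (measurable_fst hC).inter (MeasurableSet.iInter fun i => (h i hA).compl) using 1
    ext p
    simp
  have hmap := map_sequences_eq_prod hX.measurable hH hXH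
  have h1 : P ({ω | pointCount (fun i => X i ω) I = k} ∩ {ω | ∀ i, (X i ω, H i ω) ∉ A}) =
      (P.map fun ω => ((fun i => X i ω), fun i => H i ω))
        {p : (ℕ → ℝ) × (ℕ → ℝ) | p.1 ∈ C ∧ ∀ i, (p.1 i, p.2 i) ∉ A} := by
    rw [Measure.map_apply (hXm.prodMk hHm) hS]; rfl
  -- Given the positions, a mark at `x` avoids `A` with probability `expNeg (f x)`. Thus the void
  -- probability is a Laplace functional of the positions, and `1 - expNeg (f x)` is the mass under
  -- `ν` of the section of `A` at `x`.
  let f : ℝ → ENNReal := fun x => negLog (ν (Prod.mk x ⁻¹' Aᶜ))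
  have hf : Measurable f := measurable_negLog.comp (measurable_measure_prodMk_left hA.compl)
  rw [h1, hmap, Measure.prod_apply hS, lintegral_map (measurable_measure_prodMk_left hS) hXm]
  have h2 : ∀ ω, (P.map fun ω i => H i ω) (Prod.mk (fun i => X i ω) ⁻¹'
      {p : (ℕ → ℝ) × (ℕ → ℝ) | p.1 ∈ C ∧ ∀ i, (p.1 i, p.2 i) ∉ A}) =
      {ω | pointCount (fun i => X i ω) I = k}.indicator 1 ω * expNeg (∑' i, f (X i ω)) := by
    intro ω
    rw [Measure.map_apply hHm (measurable_prodMk_left hS)]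
    by_cases hω : pointCount (fun i => X i ω) I = k
    · rw [indicator_of_mem (by exact hω), Pi.one_apply, one_mul,
        ← measure_forall_mem_of_iIndepFun hH hν hHi
          fun i => measurable_prodMk_left (x := X i ω) hA.compl]
      congr 1
      ext ω'
      exact ⟨fun h => h.2, fun h => ⟨hω, h⟩⟩
    · rw [indicator_of_notMem (by exact hω), zero_mul]
      refine measure_mono_null (fun ω' h => ?_) measure_empty
      exact hω h.1
  simp only [h2]
  rw [hX.lintegral_expNeg_tsum hlam hI k hf, Measure.prod_apply hA]
  · congr 4
    ext x
    have hx := measurable_prodMk_left (x := x) hA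
    rw [expNeg_negLog prob_le_one, preimage_compl, prob_compl_eq_one_sub hx,
      ENNReal.sub_sub_cancel ENNReal.one_ne_top prob_le_one]
  · intro x hx
    have : Prod.mk x ⁻¹' Aᶜ = univ := eq_univ_of_forall fun y hy => hAI _ hy hx
    simp only [f, this, measure_univ, negLog_one]

end BuildingProcess

/-! ### Exponential integrals and comparison of independent variables -/

theorem lintegral_Ioi_mul_expNeg_mul {g : ENNReal} (hg0 : g ≠ 0) (hg : g ≠ ⊤) {u : ℝ}
    (hu : 0 ≤ u) :
    ∫⁻ t in Ioi u, g * expNeg (g * ENNReal.ofReal t) = expNeg (g * ENNReal.ofReal u) := by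
  obtain ⟨c, rfl⟩ : ∃ c : ℝ, g = ENNReal.ofReal c := ⟨g.toReal, (ENNReal.ofReal_toReal hg).symm⟩
  have hc : 0 < c := by simpa using hg0
  have hd : ∀ t : ℝ, HasDerivAt (fun t => -Real.exp (-(c * t))) (c * Real.exp (-(c * t))) t := by
    intro t
    have h := (((hasDerivAt_id t).const_mul c).neg.exp).neg
    refine h.congr_deriv ?_
    simp; ring
  have hlim : Filter.Tendsto (fun t : ℝ => -Real.exp (-(c * t))) Filter.atTop (nhds 0) := by
    have h := (Real.tendsto_exp_neg_atTop_nhds_zero.comp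
      (Filter.tendsto_id.const_mul_atTop hc)).neg
    simpa using h
  have hpos : ∀ t ∈ Ioi u, 0 ≤ c * Real.exp (-(c * t)) := fun t _ => by positivity
  have h1 := integral_Ioi_of_hasDerivAt_of_nonneg' (a := u) (fun t _ => hd t) hpos hlim
  have h2 := integrableOn_Ioi_deriv_of_nonneg' (a := u) (fun t _ => hd t) hpos hlim
  have h3 := ofReal_integral_eq_lintegral_ofReal h2 (ae_of_all _ fun t => by positivity)
  rw [← ENNReal.ofReal_mul hc.le, expNeg_ofReal (mul_nonneg hc.le hu)]
  rw [h1] at h3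
  rw [show (0 : ℝ) - -Real.exp (-(c * u)) = Real.exp (-(c * u)) by ring] at h3
  rw [h3]
  refine setLIntegral_congr_fun measurableSet_Ioi fun t ht => ?_
  have ht0 : 0 ≤ t := hu.trans (le_of_lt ht)
  rw [← ENNReal.ofReal_mul hc.le, expNeg_ofReal (mul_nonneg hc.le ht0), ENNReal.ofReal_mul hc.le]

/-- This integral, with rate λG(u), produces the square in the denominator of the mean length. -/
theorem lintegral_Ioi_ofReal_mul_expNeg_mul {g : ENNReal} (hg0 : g ≠ 0) (hg : g ≠ ⊤) :
    ∫⁻ t in Ioi (0 : ℝ), ENNReal.ofReal t * expNeg (g * ENNReal.ofReal t) = (g ^ 2)⁻¹ := by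
  obtain ⟨c, rfl⟩ : ∃ c : ℝ, g = ENNReal.ofReal c := ⟨g.toReal, (ENNReal.ofReal_toReal hg).symm⟩
  have hc : 0 < c := by simpa using hg0
  have hd : ∀ t : ℝ, HasDerivAt (fun t => -((c⁻¹ * t + (c ^ 2)⁻¹) * Real.exp (-(c * t))))
      (t * Real.exp (-(c * t))) t := by
    intro t
    have h := ((((hasDerivAt_id t).const_mul c⁻¹).add_const ((c ^ 2)⁻¹)).mul
      ((hasDerivAt_id t).const_mul c).neg.exp).neg
    refine h.congr_deriv ?_
    simp
    field_simp
    ring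
  have hlim : Filter.Tendsto (fun t : ℝ => -((c⁻¹ * t + (c ^ 2)⁻¹) * Real.exp (-(c * t))))
      Filter.atTop (nhds 0) := by
    have h1 := (tendsto_rpow_mul_exp_neg_mul_atTop_nhds_zero 1 c hc).const_mul c⁻¹
    have h0 := (tendsto_rpow_mul_exp_neg_mul_atTop_nhds_zero 0 c hc).const_mul (c ^ 2)⁻¹
    have h := (h1.add h0).neg
    simp only [mul_zero, add_zero, neg_zero, Real.rpow_one, Real.rpow_zero, one_mul] at h
    refine h.congr fun t => ?_
    rw [neg_mul]; ring
  have hpos : ∀ t ∈ Ioi (0 : ℝ), 0 ≤ t * Real.exp (-(c * t)) := fun t ht =>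
    mul_nonneg (le_of_lt ht) (Real.exp_pos _).le
  have h1 := integral_Ioi_of_hasDerivAt_of_nonneg' (a := 0) (fun t _ => hd t) hpos hlim
  have h2 := integrableOn_Ioi_deriv_of_nonneg' (a := 0) (fun t _ => hd t) hpos hlim
  have h3 := ofReal_integral_eq_lintegral_ofReal h2
    ((ae_restrict_iff' measurableSet_Ioi).2 (ae_of_all _ hpos))
  rw [h1] at h3
  rw [← ENNReal.ofReal_pow hc.le, ← ENNReal.ofReal_inv_of_pos (by positivity)]
  simp only [mul_zero, zero_add, neg_zero, Real.exp_zero, mul_one, sub_neg_eq_add] at h3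
  rw [h3]
  refine setLIntegral_congr_fun measurableSet_Ioi fun t ht => ?_
  have ht0 : 0 ≤ t := le_of_lt ht
  rw [← ENNReal.ofReal_mul hc.le, expNeg_ofReal (mul_nonneg hc.le ht0), ENNReal.ofReal_mul ht0]

/-- Change of variables along a line of slope `1 / t`, turning abscissas into heights. It serves for
both signs of `t`. -/
theorem lintegral_comp_add_sub_div (f : ℝ → ENNReal) (a b : ℝ) {t : ℝ} (ht : t ≠ 0) :
    ∫⁻ s, f (b + (s - a) / t) = ENNReal.ofReal |t| * ∫⁻ v, f v := by
  have hinj : Function.Injective fun s : ℝ => b + (s - a) / t := fun x y h => by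
    have h1 : (x - a) / t = (y - a) / t := add_left_cancel h
    linarith [(div_left_inj' ht).1 h1]
  have hsurj : Function.Surjective fun s : ℝ => b + (s - a) / t := fun y =>
    ⟨(y - b) * t + a, by field_simp; ring⟩
  have h := lintegral_image_eq_lintegral_abs_deriv_mul (s := univ) MeasurableSet.univ
    (f := fun s => b + (s - a) / t) (f' := fun _ => 1 / t)
    (fun x _ => ((((hasDerivAt_id x).sub_const a).div_const t).const_add b).hasDerivWithinAt)
    hinj.injOn f
  rw [image_univ, hsurj.range_eq] at h
  simp only [Measure.restrict_univ] at h
  have hm : ENNReal.ofReal |t| * ENNReal.ofReal |1 / t| = 1 := by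
    rw [← ENNReal.ofReal_mul (abs_nonneg _), ← abs_mul, mul_one_div_cancel ht, abs_one,
      ENNReal.ofReal_one]
  rw [h, lintegral_const_mul' _ _ ENNReal.ofReal_ne_top, ← mul_assoc, hm, one_mul]

/-- Upper and lower half-lines form π-systems generating the σ-algebra of [0, ∞]. -/
theorem indepFun_of_measure_le_inter_le {Ω : Type*} [MeasurableSpace Ω] {Q : Measure Ω}
    [IsProbabilityMeasure Q] {T U : Ω → ENNReal} (hT : Measurable T) (hU : Measurable U)
    (h : ∀ s t, Q ({ω | t ≤ T ω} ∩ {ω | U ω ≤ s}) = Q {ω | t ≤ T ω} * Q {ω | U ω ≤ s}) :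
    IndepFun T U Q := by
  refine IndepSets.indep hT.comap_le hU.comap_le
    ((isPiSystem_image_Ici (univ : Set ENNReal)).comap T) ((isPiSystem_Iic (α := ENNReal)).comap U)
    ?_ ?_ ?_
  · rw [BorelSpace.measurable_eq (α := ENNReal), borel_eq_generateFrom_Ici,
      MeasurableSpace.comap_generateFrom, image_univ]
    rfl
  · rw [BorelSpace.measurable_eq (α := ENNReal), borel_eq_generateFrom_Iic,
      MeasurableSpace.comap_generateFrom]
    rfl
  · rw [IndepSets_iff]
    rintro _ _ ⟨_, ⟨t, -, rfl⟩, rfl⟩ ⟨_, ⟨s, rfl⟩, rfl⟩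
    exact h s t

/-- The probability that `U ≤ T`, where `T` is exponential with parameter `g`, and independent
of `U`. -/
theorem measure_le_of_exponential {Ω : Type*} [MeasurableSpace Ω] {Q : Measure Ω}
    [IsProbabilityMeasure Q] {T U : Ω → ENNReal} (hT : Measurable T) (hU : Measurable U)
    {g : ENNReal} (hg0 : g ≠ 0) (hg : g ≠ ⊤)
    (h : ∀ s t, Q ({ω | t ≤ T ω} ∩ {ω | U ω ≤ s}) = expNeg (g * t) * Q {ω | U ω ≤ s}) :
    Q {ω | U ω ≤ T ω} = ∫⁻ t in Ioi (0 : ℝ),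
      g * expNeg (g * ENNReal.ofReal t) * Q {ω | U ω ≤ ENNReal.ofReal t} := by
  have hTt : ∀ t, Q {ω | t ≤ T ω} = expNeg (g * t) := fun t => by
    -- For `s = ⊤` the condition on `U` is void, which leaves the law of `T`.
    have h1 := h ⊤ t
    simpa using h1
  have hind : IndepFun T U Q :=
    indepFun_of_measure_le_inter_le hT hU fun s t => by rw [h, hTt]
  have hmap := (indepFun_iff_map_prod_eq_prod_map_map hT.aemeasurable hU.aemeasurable).1 hind
  have hS : MeasurableSet {p : ENNReal × ENNReal | p.2 ≤ p.1} :=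
    measurableSet_le measurable_snd measurable_fst
  have h1 : Q {ω | U ω ≤ T ω} = ∫⁻ ω, expNeg (g * U ω) ∂Q := by
    have : {ω | U ω ≤ T ω} = (fun ω => (T ω, U ω)) ⁻¹' {p : ENNReal × ENNReal | p.2 ≤ p.1} := rfl
    rw [this, ← Measure.map_apply (hT.prodMk hU) hS, hmap, Measure.prod_apply_symm hS,
      lintegral_map (measurable_measure_prodMk_right hS) hU]
    refine lintegral_congr fun ω => ?_
    rw [Measure.map_apply hT (measurable_prodMk_right hS)]
    exact hTt (U ω)
  -- The probability is the mean of `expNeg (g * U)`. Writing this exponential as the integral of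
  -- the density of `T` beyond `U` and exchanging the integrals leaves the distribution function of
  -- `U`.
  have h2 : ∀ u : ENNReal, expNeg (g * u) = ∫⁻ t in Ioi (0 : ℝ),
      g * expNeg (g * ENNReal.ofReal t) * (Ici u).indicator 1 (ENNReal.ofReal t) := by
    intro u
    by_cases hu : u = ⊤
    · rw [hu, ENNReal.mul_top hg0, expNeg_top]
      simp
    · have hsplit : ∀ t ∈ Ioi (0 : ℝ), g * expNeg (g * ENNReal.ofReal t) *
          (Ici u).indicator 1 (ENNReal.ofReal t) =
          (Ici u.toReal).indicator (fun t => g * expNeg (g * ENNReal.ofReal t)) t := by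
        intro t ht
        by_cases hut : u ≤ ENNReal.ofReal t
        · rw [indicator_of_mem (by exact hut), indicator_of_mem, Pi.one_apply, mul_one]
          exact ENNReal.toReal_le_of_le_ofReal (le_of_lt ht) hut
        · rw [indicator_of_notMem (by exact hut), indicator_of_notMem, mul_zero]
          exact fun h => hut ((ENNReal.le_ofReal_iff_toReal_le hu (le_of_lt ht)).2 h)
      rw [setLIntegral_congr_fun measurableSet_Ioi hsplit, setLIntegral_indicator measurableSet_Ici]
      have hae : (Ici u.toReal ∩ Ioi 0 : Set ℝ) =ᵐ[volume] Ioi u.toReal := by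
        have h0 : (Ioi u.toReal : Set ℝ) = Ioi u.toReal ∩ Ioi 0 :=
          (inter_eq_left.2 (Ioi_subset_Ioi ENNReal.toReal_nonneg)).symm
        rw [h0]
        exact Ioi_ae_eq_Ici.symm.inter (ae_eq_refl _)
      rw [setLIntegral_congr hae, lintegral_Ioi_mul_expNeg_mul hg0 hg ENNReal.toReal_nonneg,
        ENNReal.ofReal_toReal hu]
  have hms : MeasurableSet {p : Ω × ℝ | U p.1 ≤ ENNReal.ofReal p.2} :=
    measurableSet_le (hU.comp measurable_fst) (ENNReal.measurable_ofReal.comp measurable_snd)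
  have hmeas : Measurable fun p : Ω × ℝ => g * expNeg (g * ENNReal.ofReal p.2) *
      (Ici (U p.1)).indicator 1 (ENNReal.ofReal p.2) := by
    have e : (fun p : Ω × ℝ => (Ici (U p.1)).indicator (1 : ENNReal → ENNReal) (ENNReal.ofReal p.2))
        = {p : Ω × ℝ | U p.1 ≤ ENNReal.ofReal p.2}.indicator 1 := by
      ext p; rfl
    refine Measurable.mul ?_ (e ▸ measurable_one.indicator hms)
    exact (measurable_expNeg.comp ((ENNReal.measurable_ofReal.comp measurable_snd).const_mul
      _)).const_mul _
  rw [h1, lintegral_congr fun ω => h2 (U ω), lintegral_lintegral_swap hmeas.aemeasurable]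
  refine lintegral_congr fun t => ?_
  have hgm : g * expNeg (g * ENNReal.ofReal t) ≠ ⊤ :=
    ENNReal.mul_ne_top hg ((expNeg_le_one _).trans_lt ENNReal.one_lt_top).ne
  rw [lintegral_const_mul' _ _ hgm]
  congr 1
  exact lintegral_indicator_one (hU measurableSet_Iic)

/-! ### Relaying conditions for a sequence of buildings -/

/-- The integral over `(u, ∞)` of the tail of the height distribution. -/
noncomputable def tailIntegral (ν : Measure ℝ) (u : ℝ) : ENNReal := ∫⁻ x in Ioi u, ν (Ioi x)

/-- The ground point at distance `d` on the left of `α` is eventually relayed by `(α, β)`, as far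
as the buildings `(x i, h i)` on the right of `α` and those on the left with base in `J` are
concerned. -/
def SequenceRelay (J : Set ℝ) (α β d : ℝ) (x h : ℕ → ℝ) : Prop :=
  0 < d ∧ (∀ j, x j ∈ J → α - d < x j → x j < α → h j ≤ β) ∧
    ∀ k, α < x k → β < h k → (h k - β) * d ≤ β * (x k - α) ∧
      ∀ j, x j ∈ J → α - d < x j → x j < α → (h k - β) * (α - x j) ≤ (β - h j) * (x k - α)

open Classical in
/-- The inverse of the slope from `(α, β)` to a higher building on the right. -/
noncomputable def riseRatio (α β : ℝ) (p : ℝ × ℝ) : ENNReal :=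
  if α < p.1 ∧ β < p.2 then ENNReal.ofReal ((p.1 - α) / (p.2 - β)) else ⊤

open Classical in
/-- The inverse of the slope to `(α, β)` from a building at distance less than `d` on the left. -/
noncomputable def fallRatio (J : Set ℝ) (α β d : ℝ) (p : ℝ × ℝ) : ENNReal :=
  if p.1 ∈ J ∧ α - d < p.1 ∧ p.1 < α then
    (if p.2 < β then ENNReal.ofReal ((α - p.1) / (β - p.2)) else ⊤) else 0

open Classical in
/-- The inverse of the slope to `(α, β)` from the ground at distance `d`. -/
noncomputable def groundRatio (β d : ℝ) : ENNReal :=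
  if 0 < β then ENNReal.ofReal (d / β) else ⊤

theorem measurable_riseRatio (α β : ℝ) : Measurable (riseRatio α β) := by
  refine Measurable.ite ?_ (by fun_prop) measurable_const
  exact (measurableSet_lt measurable_const measurable_fst).inter
    (measurableSet_lt measurable_const measurable_snd)

theorem measurable_fallRatio {J : Set ℝ} (hJ : MeasurableSet J) (α β d : ℝ) :
    Measurable (fallRatio J α β d) := by
  refine Measurable.ite ?_ (Measurable.ite ?_ (by fun_prop) measurable_const) measurable_const
  · exact (measurable_fst hJ).inter ((measurableSet_lt measurable_const measurable_fst).inter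
      (measurableSet_lt measurable_fst measurable_const))
  · exact measurableSet_lt measurable_snd measurable_const

theorem ofReal_div_le_ofReal_div_iff {a b c e : ℝ} (hb : 0 < b) (hc : 0 ≤ c) (he : 0 < e) :
    ENNReal.ofReal (a / b) ≤ ENNReal.ofReal (c / e) ↔ e * a ≤ b * c := by
  rw [ENNReal.ofReal_le_ofReal_iff (div_nonneg hc he.le), div_le_div_iff₀ hb he, mul_comm a,
    mul_comm c]

/-- Comparison of slopes becomes comparison of their inverses. Irrelevant buildings get the neutral
values, ⊤ for the infimum and 0 for the supremum, and a building on the left of height at least `β`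
gets ⊤. A higher building on the right makes the infimum finite, which is what lets the inequality
exclude such left buildings. -/
theorem sequenceRelay_iff {J : Set ℝ} {α β d : ℝ} (hd : 0 < d) {x h : ℕ → ℝ}
    (hex : ∃ k, α < x k ∧ β < h k) :
    SequenceRelay J α β d x h ↔
      groundRatio β d ⊔ ⨆ j, fallRatio J α β d (x j, h j) ≤ ⨅ k, riseRatio α β (x k, h k) := by
  rw [sup_le_iff, le_iInf_iff, iSup_le_iff]
  constructor
  · rintro ⟨-, hle, hk⟩
    constructor
    · intro k
      rw [riseRatio]
      split_ifs with h1
      · obtain ⟨h2, -⟩ := hk k h1.1 h1.2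
        have h3 : 0 < (h k - β) * d := mul_pos (sub_pos.2 h1.2) hd
        have hβ : 0 < β := pos_of_mul_pos_left (h3.trans_le h2) (sub_pos.2 h1.1).le
        rw [groundRatio, if_pos hβ,
          ofReal_div_le_ofReal_div_iff hβ (sub_pos.2 h1.1).le (sub_pos.2 h1.2)]
        exact h2
      · exact le_top
    · intro j
      refine le_iInf fun k => ?_
      rw [riseRatio]
      split_ifs with h1
      · rw [fallRatio]
        split_ifs with h2 h3
        · rw [ofReal_div_le_ofReal_div_iff (sub_pos.2 h3) (sub_pos.2 h1.1).le (sub_pos.2 h1.2)]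
          exact (hk k h1.1 h1.2).2 j h2.1 h2.2.1 h2.2.2
        · exfalso
          have h4 := (hk k h1.1 h1.2).2 j h2.1 h2.2.1 h2.2.2
          have h5 : 0 < (h k - β) * (α - x j) := mul_pos (sub_pos.2 h1.2) (sub_pos.2 h2.2.2)
          exact h3 (sub_pos.1 (pos_of_mul_pos_left (h5.trans_le h4) (sub_pos.2 h1.1).le))
        · exact zero_le
      · exact le_top
  · rintro ⟨h1, h2⟩
    have hfall : ∀ k, α < x k → β < h k → ∀ j, x j ∈ J → α - d < x j → x j < α →
        h j < β ∧ (h k - β) * (α - x j) ≤ (β - h j) * (x k - α) := by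
      intro k hk hk' j hj hj' hj''
      have h3 := (h2 j).trans (iInf_le _ k)
      rw [fallRatio, if_pos ⟨hj, hj', hj''⟩] at h3
      rw [riseRatio, if_pos (show α < x k ∧ β < h k from ⟨hk, hk'⟩)] at h3
      by_cases h4 : h j < β
      · rw [if_pos h4] at h3
        exact ⟨h4, (ofReal_div_le_ofReal_div_iff (sub_pos.2 h4) (sub_pos.2 hk).le
          (sub_pos.2 hk')).1 h3⟩
      · rw [if_neg h4] at h3
        exact absurd h3 (not_le.2 ENNReal.ofReal_lt_top)
    obtain ⟨k₀, hk₀, hk₀'⟩ := hex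
    refine ⟨hd, fun j hj hj' hj'' => (hfall k₀ hk₀ hk₀' j hj hj' hj'').1.le, fun k hk hk' =>
      ⟨?_, fun j hj hj' hj'' => (hfall k hk hk' j hj hj' hj'').2⟩⟩
    have h3 := h1 k
    rw [riseRatio, if_pos (show α < x k ∧ β < h k from ⟨hk, hk'⟩), groundRatio] at h3
    split_ifs at h3 with h4
    · exact (ofReal_div_le_ofReal_div_iff h4 (sub_pos.2 hk).le (sub_pos.2 hk')).1 h3
    · exact absurd h3 (not_le.2 ENNReal.ofReal_lt_top)

theorem groundRatio_le_ofReal_iff {β d t : ℝ} (hβ : 0 ≤ β) (hd : 0 < d) (ht : 0 < t) :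
    groundRatio β d ≤ ENNReal.ofReal t ↔ d ≤ β * t := by
  rw [groundRatio]
  split_ifs with h
  · rw [ENNReal.ofReal_le_ofReal_iff ht.le, div_le_iff₀ h, mul_comm]
  · rw [le_antisymm (not_lt.1 h) hβ]
    simp [hd]

/-! ### Intensities of the regions above a line through (α, β). -/

section Intensity

variable {ν : Measure ℝ}

theorem measurable_measure_Ioi : Measurable fun x => ν (Ioi x) :=
  (show Antitone fun x => ν (Ioi x) from fun _ _ h => measure_mono (Ioi_subset_Ioi h)).measurable

theorem antitone_tailIntegral : Antitone (tailIntegral ν) := fun _ _ h =>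
  lintegral_mono_set (Ioi_subset_Ioi h)

theorem lintegral_Ioo_add_tailIntegral {u β : ℝ} (hu : u < β) :
    (∫⁻ v in Ioo u β, ν (Ioi v)) + tailIntegral ν β = tailIntegral ν u := by
  rw [tailIntegral, tailIntegral, setLIntegral_congr (Ioi_ae_eq_Ici (a := β)),
    ← Ioo_union_Ici_eq_Ioi hu, lintegral_union measurableSet_Ici]
  exact Set.disjoint_left.2 fun x hx hx' => not_lt.2 hx' hx.2

variable [IsProbabilityMeasure ν]

/-- At abscissa `a > α` the region consists of the heights above the line of slope `1 / t` through
(α, β), that is, above `v = β + (a - α) / t`. The substitution `v` contributes the factor `t`. -/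
theorem intensity_riseRatio_lt (α β : ℝ) {t : ℝ} (ht : 0 ≤ t) :
    (volume.prod ν) {p | riseRatio α β p < ENNReal.ofReal t} =
      ENNReal.ofReal t * tailIntegral ν β := by
  rcases ht.eq_or_lt with rfl | ht
  · simp
  have hm : MeasurableSet {p | riseRatio α β p < ENNReal.ofReal t} :=
    measurable_riseRatio α β measurableSet_Iio
  rw [Measure.prod_apply hm, tailIntegral,
    ← lintegral_indicator measurableSet_Ioi]
  have h := lintegral_comp_add_sub_div ((Ioi β).indicator fun x => ν (Ioi x)) α β ht.ne'
  rw [abs_of_pos ht] at h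
  rw [← h]
  refine lintegral_congr fun a => ?_
  by_cases ha : α < a
  · have h1 : 0 < (a - α) / t := div_pos (sub_pos.2 ha) ht
    rw [indicator_of_mem (by simpa using h1)]
    congr 1
    ext b
    simp only [mem_preimage, mem_ofPred_eq, mem_Ioi, riseRatio, ha, true_and]
    split_ifs with hb
    · rw [ENNReal.ofReal_lt_ofReal_iff ht, div_lt_iff₀ (sub_pos.2 hb), ← lt_sub_iff_add_lt',
        div_lt_iff₀ ht, mul_comm]
    · simp only [not_top_lt, false_iff, not_lt]
      linarith
  · rw [indicator_of_notMem]
    · refine measure_mono_null (fun b hb => ?_) measure_empty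
      simp [riseRatio, ha] at hb
    · simp only [mem_Ioi, lt_add_iff_pos_right, not_lt]
      exact div_nonpos_of_nonpos_of_nonneg (by linarith) ht.le

theorem intensity_riseRatio_lt_top (α : ℝ) {β : ℝ} (hβ : tailIntegral ν β ≠ 0) :
    (volume.prod ν) {p | riseRatio α β p < ⊤} = ⊤ := by
  have h : ∀ n : ℕ, (n : ENNReal) * tailIntegral ν β ≤ (volume.prod ν) {p | riseRatio α β p < ⊤} := by
    intro n
    have := intensity_riseRatio_lt (ν := ν) α β (Nat.cast_nonneg n)
    rw [ENNReal.ofReal_natCast] at this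
    rw [← this]
    exact measure_mono fun p hp => lt_of_lt_of_le (show riseRatio α β p < (n : ENNReal) from hp) le_top
  have h2 : (⨆ n : ℕ, (n : ENNReal)) * tailIntegral ν β ≤
      (volume.prod ν) {p | riseRatio α β p < ⊤} := by
    rw [ENNReal.iSup_mul]
    exact iSup_le h
  rw [ENNReal.iSup_natCast, ENNReal.top_mul hβ] at h2
  exact top_le_iff.1 h2

/-- The same line, prolonged to the left over a distance `d`, passes through the heights from `β - d
/ t` to `β`. -/
theorem intensity_lt_fallRatio_univ (α β d : ℝ) {t : ℝ} (ht : 0 < t) :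
    (volume.prod ν) {p | ENNReal.ofReal t < fallRatio univ α β d p} =
      ENNReal.ofReal t * ∫⁻ v in Ioo (β - d / t) β, ν (Ioi v) := by
  have hm : MeasurableSet {p | ENNReal.ofReal t < fallRatio univ α β d p} :=
    measurable_fallRatio MeasurableSet.univ α β d measurableSet_Ioi
  rw [Measure.prod_apply hm,
    ← lintegral_indicator measurableSet_Ioo]
  have h := lintegral_comp_add_sub_div ((Ioo (β - d / t) β).indicator fun x => ν (Ioi x)) α β ht.ne'
  rw [abs_of_pos ht] at h
  rw [← h]
  refine lintegral_congr fun a => ?_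
  have hiff : β + (a - α) / t ∈ Ioo (β - d / t) β ↔ α - d < a ∧ a < α := by
    rw [mem_Ioo, add_lt_iff_neg_left, div_lt_iff₀ ht, zero_mul, sub_eq_add_neg β,
      add_lt_add_iff_left, ← neg_div, div_lt_div_iff_of_pos_right ht]
    constructor <;> rintro ⟨h1, h2⟩ <;> constructor <;> linarith
  by_cases ha : α - d < a ∧ a < α
  · rw [indicator_of_mem (hiff.2 ha)]
    congr 1
    ext b
    simp only [mem_preimage, mem_ofPred_eq, mem_Ioi, fallRatio, mem_univ, ha, and_self, if_true]
    have h1 : (a - α) / t < 0 := div_neg_of_neg_of_pos (by linarith) ht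
    split_ifs with hb
    · have hs : 0 < β - b := sub_pos.2 hb
      rw [ENNReal.ofReal_lt_ofReal_iff (div_pos (by linarith) hs), lt_div_iff₀ hs,
        ← lt_sub_iff_add_lt', div_lt_iff₀ ht]
      constructor <;> intro h <;> linarith
    · simp only [ENNReal.ofReal_lt_top, true_iff]
      linarith
  · rw [indicator_of_notMem (fun h => ha (hiff.1 h))]
    refine measure_mono_null (fun b hb => ?_) measure_empty
    simp [fallRatio, ha] at hb

theorem intensity_lt_fallRatio_le (J : Set ℝ) (α β d : ℝ) {t : ℝ} (ht : 0 < t) :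
    (volume.prod ν) {p | ENNReal.ofReal t < fallRatio J α β d p} ≤
      ENNReal.ofReal t * ∫⁻ v in Ioo (β - d / t) β, ν (Ioi v) := by
  rw [← intensity_lt_fallRatio_univ α β d ht]
  refine measure_mono fun p hp => ?_
  have hp : ENNReal.ofReal t < fallRatio J α β d p := hp
  refine hp.trans_le ?_
  simp only [fallRatio, mem_univ, true_and]
  split_ifs <;> simp_all

end Intensity

/-! ### The expected length of the zone -/

section ExpectedLength

variable {Ω : Type*} [MeasurableSpace Ω] {Q : Measure Ω} [IsProbabilityMeasure Q] {lam : ℝ}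
  {X H : ℕ → Ω → ℝ} {ν : Measure ℝ} [IsProbabilityMeasure ν] {J : Set ℝ} {α β : ℝ}

/-- The supremum `U` and the infimum `T` are governed by void events of disjoint regions, so they
are independent and `T` is exponential. Void probabilities are required only over `J`, so that `Q`
may also be the law conditioned on the buildings outside `J`. -/
theorem measure_sequenceRelay (hlam : 0 < lam) (hX : ∀ i, Measurable (X i))
    (hH : ∀ i, Measurable (H i)) (hJ : MeasurableSet J) (hαJ : Ioi α ⊆ J)
    (hvoid : ∀ A : Set (ℝ × ℝ), MeasurableSet A → (∀ p ∈ A, p.1 ∈ J) →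
      Q {ω | ∀ i, (X i ω, H i ω) ∉ A} = expNeg (ENNReal.ofReal lam * (volume.prod ν) A))
    (hβ : 0 ≤ β) (hG0 : tailIntegral ν β ≠ 0) (hG : tailIntegral ν β ≠ ⊤) {d : ℝ} (hd : 0 < d) :
    Q {ω | SequenceRelay J α β d (fun i => X i ω) (fun i => H i ω)} =
      ∫⁻ t in Ioi (0 : ℝ), (ENNReal.ofReal lam * tailIntegral ν β) *
        expNeg (ENNReal.ofReal lam * tailIntegral ν β * ENNReal.ofReal t) *
        (Ici (d / t)).indicator 1 β * expNeg (ENNReal.ofReal lam *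
          (volume.prod ν) {p | ENNReal.ofReal t < fallRatio J α β d p}) := by
  set g := ENNReal.ofReal lam * tailIntegral ν β with hg_def
  have hlam0 : ENNReal.ofReal lam ≠ 0 := by simpa using hlam
  have hg0 : g ≠ 0 := mul_ne_zero hlam0 hG0
  have hg : g ≠ ⊤ := ENNReal.mul_ne_top ENNReal.ofReal_ne_top hG
  have hpt : ∀ i, Measurable fun ω => (X i ω, H i ω) := fun i => (hX i).prodMk (hH i)
  let T : Ω → ENNReal := fun ω => ⨅ k, riseRatio α β (X k ω, H k ω)
  let U : Ω → ENNReal := fun ω => groundRatio β d ⊔ ⨆ j, fallRatio J α β d (X j ω, H j ω)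
  have hT : Measurable T := Measurable.iInf fun k => (measurable_riseRatio α β).comp (hpt k)
  have hU : Measurable U :=
    measurable_const.sup (Measurable.iSup fun j => (measurable_fallRatio hJ α β d).comp (hpt j))
  have hmr : ∀ t, MeasurableSet {p | riseRatio α β p < t} := fun t =>
    measurable_riseRatio α β measurableSet_Iio
  have hmf : ∀ s, MeasurableSet {p | s < fallRatio J α β d p} := fun s =>
    measurable_fallRatio hJ α β d measurableSet_Ioi
  have hrise : ∀ t, ∀ p ∈ {p | riseRatio α β p < t}, α < p.1 := by
    intro t p hp
    by_contra h
    have hp : riseRatio α β p < t := hp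
    rw [riseRatio, if_neg fun h' => h h'.1] at hp
    exact not_top_lt hp
  have hfall : ∀ s, ∀ p ∈ {p | s < fallRatio J α β d p}, p.1 ∈ J ∧ p.1 < α := by
    intro s p hp
    by_contra h
    have hp : s < fallRatio J α β d p := hp
    rw [fallRatio, if_neg fun h' => h ⟨h'.1, h'.2.2⟩] at hp
    exact not_lt_zero hp
  have hdisj : ∀ s t, Disjoint {p | riseRatio α β p < t} {p | s < fallRatio J α β d p} :=
    fun s t => Set.disjoint_left.2 fun p hp hp' => lt_asymm (hrise t p hp) (hfall s p hp').2
  have hTU : ∀ s t, groundRatio β d ≤ s → {ω | t ≤ T ω} ∩ {ω | U ω ≤ s} =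
      {ω | ∀ i, (X i ω, H i ω) ∉
        {p | riseRatio α β p < t} ∪ {p | s < fallRatio J α β d p}} := by
    intro s t hs
    ext ω
    simp only [T, U, mem_inter_iff, mem_ofPred_eq, le_iInf_iff, sup_le_iff, hs, true_and,
      iSup_le_iff, mem_union, not_or, not_lt, forall_and]
  have hUs : ∀ s, groundRatio β d ≤ s → Q {ω | U ω ≤ s} =
      expNeg (ENNReal.ofReal lam * (volume.prod ν) {p | s < fallRatio J α β d p}) := by
    intro s hs
    rw [← hvoid _ (hmf s) fun p hp => (hfall s p hp).1]
    have h1 := hTU s 0 hs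
    simp only [zero_le, ofPred_true, univ_inter, not_lt_zero, ofPred_false, empty_union] at h1
    rw [h1]
  have hrate : ∀ t, ENNReal.ofReal lam * (volume.prod ν) {p | riseRatio α β p < t} = g * t := by
    intro t
    by_cases ht : t = ⊤
    · rw [ht, intensity_riseRatio_lt_top α hG0, ENNReal.mul_top hlam0, ENNReal.mul_top hg0]
    · have h1 := intensity_riseRatio_lt (ν := ν) α β (t := t.toReal) ENNReal.toReal_nonneg
      rw [ENNReal.ofReal_toReal ht] at h1
      rw [h1, hg_def, mul_assoc, mul_comm t]
  have hind : ∀ s t, Q ({ω | t ≤ T ω} ∩ {ω | U ω ≤ s}) = expNeg (g * t) * Q {ω | U ω ≤ s} := by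
    intro s t
    by_cases hs : groundRatio β d ≤ s
    · rw [hTU s t hs, hUs s hs, hvoid _ ((hmr t).union (hmf s)),
        measure_union (hdisj s t) (hmf s), mul_add, expNeg_add, hrate]
      rintro p (hp | hp)
      · exact hαJ (hrise t p hp)
      · exact (hfall s p hp).1
    -- The ground point alone already forces `U` above `s`.
    · have h0 : {ω | U ω ≤ s} = ∅ :=
        eq_empty_of_forall_notMem fun ω hω => hs (le_sup_left.trans hω)
      rw [h0, inter_empty, measure_empty, mul_zero]
  -- Taking `s = t = ⊤` in the product formula: the exponential variable `T` is almost surely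
  -- finite, so a higher building exists on the right.
  have hTtop : ∀ᵐ ω ∂Q, T ω ≠ ⊤ := by
    have h1 := hind ⊤ ⊤
    simp only [le_top, ofPred_true, inter_univ, measure_univ, mul_one, ENNReal.mul_top hg0,
      expNeg_top, top_le_iff] at h1
    rw [ae_iff]
    simpa using h1
  have hmain : Q {ω | SequenceRelay J α β d (fun i => X i ω) (fun i => H i ω)} =
      Q {ω | U ω ≤ T ω} := by
    refine measure_congr ?_
    filter_upwards [hTtop] with ω hω
    refine propext ?_
    refine sequenceRelay_iff hd ?_
    by_contra! hcon
    refine hω (iInf_eq_top.2 fun k => if_neg fun h => ?_)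
    exact absurd h.2 (not_lt.2 (hcon k h.1))
  rw [hmain, measure_le_of_exponential hT hU hg0 hg hind]
  refine setLIntegral_congr_fun measurableSet_Ioi fun t ht => ?_
  have ht : 0 < t := ht
  by_cases hdt : d ≤ β * t
  · rw [hUs _ ((groundRatio_le_ofReal_iff hβ hd ht).2 hdt), indicator_of_mem, Pi.one_apply,
      mul_one]
    exact (div_le_iff₀ ht).2 hdt
  · have h0 : {ω | U ω ≤ ENNReal.ofReal t} = ∅ := eq_empty_of_forall_notMem fun ω hω =>
      hdt ((groundRatio_le_ofReal_iff hβ hd ht).1 (le_sup_left.trans hω))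
    rw [h0, measure_empty, mul_zero, indicator_of_notMem, mul_zero, zero_mul]
    exact fun h => hdt ((div_le_iff₀ ht).1 h)

end ExpectedLength

/-- The integral over `d` and `t` of the joint density of the distance to the ground point and
of the inverse slope. -/
theorem lintegral_lintegral_expNeg_tailIntegral {ν : Measure ℝ} {lam β : ℝ} (hlam : 0 < lam) (hβ : 0 ≤ β)
    (hG0 : tailIntegral ν β ≠ 0) (hG : ∀ u, 0 ≤ u → tailIntegral ν u ≠ ⊤) :
    ∫⁻ d in Ioi (0 : ℝ), ∫⁻ t in Ioi (0 : ℝ), (ENNReal.ofReal lam * tailIntegral ν β) *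
        expNeg (ENNReal.ofReal lam * tailIntegral ν β * ENNReal.ofReal t) *
        (Ici (d / t)).indicator 1 β * expNeg (ENNReal.ofReal lam *
          (ENNReal.ofReal t * ∫⁻ v in Ioo (β - d / t) β, ν (Ioi v))) =
      (ENNReal.ofReal lam)⁻¹ * ∫⁻ u in Ioo 0 β, tailIntegral ν β / tailIntegral ν u ^ 2 := by
  set g := ENNReal.ofReal lam * tailIntegral ν β with hg_def
  have hlam0 : ENNReal.ofReal lam ≠ 0 := by simpa using hlam
  have hg : g ≠ ⊤ := ENNReal.mul_ne_top ENNReal.ofReal_ne_top (hG β hβ)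
  let κ : ℝ → ℝ → ENNReal := fun u t =>
    expNeg (ENNReal.ofReal lam * tailIntegral ν u * ENNReal.ofReal t)
  have hGm : Measurable (tailIntegral ν) := antitone_tailIntegral.measurable
  have hκ : Measurable fun p : ℝ × ℝ => κ p.1 p.2 :=
    measurable_expNeg.comp (((hGm.comp measurable_fst).const_mul _).mul
      (ENNReal.measurable_ofReal.comp measurable_snd))
  -- The two exponents add up to λtG(u) with `u = β - d / t`, and the constraint `d ≤ β t` becomes
  -- `0 ≤ u`.
  have e1 : ∀ d ∈ Ioi (0 : ℝ), ∫⁻ t in Ioi (0 : ℝ), g * expNeg (g * ENNReal.ofReal t) *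
        (Ici (d / t)).indicator 1 β * expNeg (ENNReal.ofReal lam *
          (ENNReal.ofReal t * ∫⁻ v in Ioo (β - d / t) β, ν (Ioi v))) =
      ∫⁻ t in Ioi (0 : ℝ), g * (Ico 0 β).indicator (fun u => κ u t) (β - d / t) := by
    intro d hd
    refine setLIntegral_congr_fun measurableSet_Ioi fun t ht => ?_
    have ht : 0 < t := ht
    have hdt : 0 < d / t := div_pos hd ht
    by_cases h : d / t ≤ β
    · rw [indicator_of_mem (show β ∈ Ici (d / t) from h), indicator_of_mem, Pi.one_apply, mul_one,
        mul_assoc, ← expNeg_add]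
      · congr 2
        rw [← lintegral_Ioo_add_tailIntegral (u := β - d / t) (β := β) (by linarith), hg_def]
        ring
      · exact ⟨by linarith, by linarith⟩
    · rw [indicator_of_notMem (show β ∉ Ici (d / t) from h), indicator_of_notMem, mul_zero,
        zero_mul, mul_zero]
      exact fun h' => h (by linarith [h'.1])
  rw [setLIntegral_congr_fun measurableSet_Ioi e1]
  have hmeas : Measurable fun p : ℝ × ℝ =>
      g * (Ico 0 β).indicator (fun u => κ u p.2) (β - p.1 / p.2) := by
    refine Measurable.const_mul ?_ _
    have hφ : Measurable fun p : ℝ × ℝ => β - p.1 / p.2 := by fun_prop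
    exact (hκ.comp (hφ.prodMk measurable_snd)).indicator
      (hφ (measurableSet_Ico (a := 0) (b := β)))
  rw [lintegral_lintegral_swap hmeas.aemeasurable]
  -- For fixed `t`, the substitution `u = β - d / t` has Jacobian `t`.
  have e2 : ∀ t ∈ Ioi (0 : ℝ), ∫⁻ d in Ioi (0 : ℝ),
      g * (Ico 0 β).indicator (fun u => κ u t) (β - d / t) =
      ∫⁻ u in Ioo 0 β, g * (ENNReal.ofReal t * κ u t) := by
    intro t ht
    have ht : 0 < t := ht
    have h1 := lintegral_comp_add_sub_div ((Ioo 0 β).indicator fun u => κ u t) 0 β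
      (neg_ne_zero.2 ht.ne')
    rw [abs_neg, abs_of_pos ht, lintegral_indicator measurableSet_Ioo] at h1
    rw [lintegral_const_mul' _ _ hg, lintegral_const_mul' _ _ hg,
      lintegral_const_mul' _ _ ENNReal.ofReal_ne_top, ← h1, ← lintegral_indicator measurableSet_Ioi]
    congr 1
    refine lintegral_congr_ae ?_
    -- The excluded `d` corresponds to the endpoint `u = 0`, which lies in `Ico 0 β` but not in `Ioo
    -- 0 β`.
    have hne : ∀ᵐ d : ℝ, d ≠ β * t := by simp [ae_iff]
    filter_upwards [hne] with d hd
    have e : β + (d - 0) / -t = β - d / t := by rw [sub_zero, div_neg, sub_eq_add_neg]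
    rw [e]
    by_cases hd0 : 0 < d
    · have hdt : 0 < d / t := div_pos hd0 ht
      rw [indicator_of_mem (show d ∈ Ioi 0 from hd0)]
      by_cases h : 0 ≤ β - d / t
      · have h' : 0 < β - d / t := by
          refine h.lt_of_ne fun h0 => hd ?_
          rw [← div_eq_iff ht.ne']; linarith
        rw [indicator_of_mem, indicator_of_mem]
        · exact ⟨h', by linarith⟩
        · exact ⟨h, by linarith⟩
      · rw [indicator_of_notMem fun h' => h h'.1, indicator_of_notMem fun h' => h h'.1.le]
    · rw [indicator_of_notMem (show d ∉ Ioi 0 from hd0), indicator_of_notMem]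
      intro h'
      have : d / t ≤ 0 := div_nonpos_of_nonpos_of_nonneg (not_lt.1 hd0) ht.le
      linarith [h'.2]
  rw [setLIntegral_congr_fun measurableSet_Ioi e2, lintegral_lintegral_swap]
  · rw [← lintegral_const_mul' _ _ (ENNReal.inv_ne_top.2 hlam0)]
    refine setLIntegral_congr_fun measurableSet_Ioo fun u hu => ?_
    have hGu0 : tailIntegral ν u ≠ 0 := fun h =>
      hG0 (le_antisymm ((antitone_tailIntegral hu.2.le).trans_eq h) zero_le)
    have hr0 : ENNReal.ofReal lam * tailIntegral ν u ≠ 0 := mul_ne_zero hlam0 hGu0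
    have hr : ENNReal.ofReal lam * tailIntegral ν u ≠ ⊤ :=
      ENNReal.mul_ne_top ENNReal.ofReal_ne_top (hG u hu.1.le)
    rw [lintegral_const_mul' _ _ hg, lintegral_Ioi_ofReal_mul_expNeg_mul hr0 hr, mul_pow,
      ENNReal.mul_inv (Or.inr (ENNReal.pow_ne_top (hG u hu.1.le))) (Or.inl (by simp)), hg_def,
      div_eq_mul_inv, sq (ENNReal.ofReal lam),
      ENNReal.mul_inv (Or.inl hlam0) (Or.inl ENNReal.ofReal_ne_top)]
    calc ENNReal.ofReal lam * tailIntegral ν β *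
          ((ENNReal.ofReal lam)⁻¹ * (ENNReal.ofReal lam)⁻¹ * (tailIntegral ν u ^ 2)⁻¹)
        = (ENNReal.ofReal lam * (ENNReal.ofReal lam)⁻¹) *
          ((ENNReal.ofReal lam)⁻¹ * (tailIntegral ν β * (tailIntegral ν u ^ 2)⁻¹)) := by ring
      _ = _ := by rw [ENNReal.mul_inv_cancel hlam0 ENNReal.ofReal_ne_top, one_mul]
  · refine Measurable.aemeasurable ?_
    exact ((ENNReal.measurable_ofReal.comp measurable_fst).mul
      (hκ.comp measurable_swap)).const_mul _

/-! ### Measurability and expectation of the relay length. -/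

theorem measurableSet_sequenceRelay {J : Set ℝ} (hJ : MeasurableSet J) (α : ℝ) :
    MeasurableSet {p : (ℝ × ℝ) × ((ℕ → ℝ) × (ℕ → ℝ)) |
      SequenceRelay J α p.1.1 p.1.2 p.2.1 p.2.2} := by
  have hx : ∀ i, Measurable fun p : (ℝ × ℝ) × ((ℕ → ℝ) × (ℕ → ℝ)) => p.2.1 i := by fun_prop
  have hh : ∀ i, Measurable fun p : (ℝ × ℝ) × ((ℕ → ℝ) × (ℕ → ℝ)) => p.2.2 i := by fun_prop
  have hb : Measurable fun p : (ℝ × ℝ) × ((ℕ → ℝ) × (ℕ → ℝ)) => p.1.1 := by fun_prop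
  have hd : Measurable fun p : (ℝ × ℝ) × ((ℕ → ℝ) × (ℕ → ℝ)) => p.1.2 := by fun_prop
  have hleft : ∀ j, MeasurableSet {p : (ℝ × ℝ) × ((ℕ → ℝ) × (ℕ → ℝ)) |
      p.2.1 j ∈ J ∧ α - p.1.2 < p.2.1 j ∧ p.2.1 j < α} := fun j =>
    (hx j hJ).inter ((measurableSet_lt (measurable_const.sub hd) (hx j)).inter
      (measurableSet_lt (hx j) measurable_const))
  have himp : ∀ s t : Set ((ℝ × ℝ) × ((ℕ → ℝ) × (ℕ → ℝ))), MeasurableSet s → MeasurableSet t →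
      MeasurableSet {p | p ∈ s → p ∈ t} := fun s t hs ht => by
    convert hs.compl.union ht using 1
    ext p
    simp [imp_iff_not_or]
  have e : {p : (ℝ × ℝ) × ((ℕ → ℝ) × (ℕ → ℝ)) | SequenceRelay J α p.1.1 p.1.2 p.2.1 p.2.2} =
      {p | 0 < p.1.2} ∩ ((⋂ j, {p | p ∈ {p : (ℝ × ℝ) × ((ℕ → ℝ) × (ℕ → ℝ)) |
        p.2.1 j ∈ J ∧ α - p.1.2 < p.2.1 j ∧ p.2.1 j < α} → p ∈ {p | p.2.2 j ≤ p.1.1}}) ∩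
      ⋂ k, {p | p ∈ {p : (ℝ × ℝ) × ((ℕ → ℝ) × (ℕ → ℝ)) | α < p.2.1 k ∧ p.1.1 < p.2.2 k} →
        p ∈ {p | (p.2.2 k - p.1.1) * p.1.2 ≤ p.1.1 * (p.2.1 k - α)} ∩
          ⋂ j, {p | p ∈ {p : (ℝ × ℝ) × ((ℕ → ℝ) × (ℕ → ℝ)) |
            p.2.1 j ∈ J ∧ α - p.1.2 < p.2.1 j ∧ p.2.1 j < α} →
            p ∈ {p | (p.2.2 k - p.1.1) * (α - p.2.1 j) ≤
              (p.1.1 - p.2.2 j) * (p.2.1 k - α)}}}) := by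
    ext p
    simp only [SequenceRelay, mem_ofPred_eq, mem_inter_iff, mem_iInter, and_imp]
  rw [e]
  refine (measurableSet_lt measurable_const hd).inter ((MeasurableSet.iInter fun j =>
    himp _ _ (hleft j) (measurableSet_le (hh j) hb)).inter (MeasurableSet.iInter fun k =>
    himp _ _ ?_ (MeasurableSet.inter ?_ (MeasurableSet.iInter fun j => himp _ _ (hleft j) ?_))))
  · exact (measurableSet_lt measurable_const (hx k)).inter (measurableSet_lt hb (hh k))
  · exact measurableSet_le (((hh k).sub hb).mul hd) (hb.mul ((hx k).sub measurable_const))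
  · exact measurableSet_le (((hh k).sub hb).mul (measurable_const.sub (hx j)))
      ((hb.sub (hh j)).mul ((hx k).sub measurable_const))

/-- The length of the set of distances `d > δ` that satisfy `SequenceRelay J α β d x h`. -/
noncomputable def relayLength (J : Set ℝ) (α δ β : ℝ) (x h : ℕ → ℝ) : ENNReal :=
  volume {d | δ < d ∧ SequenceRelay J α β d x h}

theorem measurable_relayLength {J : Set ℝ} (hJ : MeasurableSet J) (α δ : ℝ) :
    Measurable fun p : ℝ × ((ℕ → ℝ) × (ℕ → ℝ)) => relayLength J α δ p.1 p.2.1 p.2.2 := by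
  have hS : MeasurableSet {q : (ℝ × ((ℕ → ℝ) × (ℕ → ℝ))) × ℝ |
      δ < q.2 ∧ SequenceRelay J α q.1.1 q.2 q.1.2.1 q.1.2.2} := by
    have hφ : Measurable fun q : (ℝ × ((ℕ → ℝ) × (ℕ → ℝ))) × ℝ => ((q.1.1, q.2), q.1.2) := by
      fun_prop
    exact (measurableSet_lt measurable_const measurable_snd).inter
      (hφ (measurableSet_sequenceRelay hJ α))
  exact measurable_measure_prodMk_left hS

section ExpectedLength

variable {Ω : Type*} [MeasurableSpace Ω] {Q : Measure Ω} [IsProbabilityMeasure Q] {lam : ℝ}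
  {X H : ℕ → Ω → ℝ} {ν : Measure ℝ} [IsProbabilityMeasure ν] {J : Set ℝ} {α β : ℝ}

/-- Tonelli's theorem: the mean measure of a random set of distances is the integral of the
probability that it contains `d`. -/
theorem lintegral_relayLength (hX : ∀ i, Measurable (X i)) (hH : ∀ i, Measurable (H i))
    (hJ : MeasurableSet J) (δ : ℝ) :
    ∫⁻ ω, relayLength J α δ β (fun i => X i ω) (fun i => H i ω) ∂Q =
      ∫⁻ d in Ioi δ, Q {ω | SequenceRelay J α β d (fun i => X i ω) (fun i => H i ω)} := by
  have hφ : Measurable fun q : Ω × ℝ => (((β, q.2) : ℝ × ℝ),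
      (((fun i => X i q.1) : ℕ → ℝ), ((fun i => H i q.1) : ℕ → ℝ))) := by
    refine Measurable.prodMk (by fun_prop) (Measurable.prodMk ?_ ?_)
    · exact measurable_pi_lambda _ fun i => (hX i).comp measurable_fst
    · exact measurable_pi_lambda _ fun i => (hH i).comp measurable_fst
  have hS := hφ (measurableSet_sequenceRelay hJ α)
  have h1 : ∀ ω, relayLength J α δ β (fun i => X i ω) (fun i => H i ω) =
      (volume.restrict (Ioi δ)) {d | SequenceRelay J α β d (fun i => X i ω) (fun i => H i ω)} := by
    intro ω
    have hω : MeasurableSet {d | SequenceRelay J α β d (fun i => X i ω) (fun i => H i ω)} :=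
      measurable_prodMk_left (x := ω) hS
    rw [Measure.restrict_apply hω, relayLength, inter_comm]
    rfl
  simp only [h1]
  exact ((Measure.prod_apply (μ := Q) (ν := volume.restrict (Ioi δ)) hS).symm.trans
    (Measure.prod_apply_symm hS))

theorem lintegral_relayLength_univ (hlam : 0 < lam) (hX : ∀ i, Measurable (X i))
    (hH : ∀ i, Measurable (H i))
    (hvoid : ∀ A : Set (ℝ × ℝ), MeasurableSet A →
      Q {ω | ∀ i, (X i ω, H i ω) ∉ A} = expNeg (ENNReal.ofReal lam * (volume.prod ν) A))
    (hβ : 0 ≤ β) (hG0 : tailIntegral ν β ≠ 0) (hG : ∀ u, 0 ≤ u → tailIntegral ν u ≠ ⊤) :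
    ∫⁻ ω, relayLength univ α 0 β (fun i => X i ω) (fun i => H i ω) ∂Q =
      (ENNReal.ofReal lam)⁻¹ * ∫⁻ u in Ioo 0 β, tailIntegral ν β / tailIntegral ν u ^ 2 := by
  rw [lintegral_relayLength hX hH MeasurableSet.univ 0,
    ← lintegral_lintegral_expNeg_tailIntegral hlam hβ hG0 hG]
  refine setLIntegral_congr_fun measurableSet_Ioi fun d hd => ?_
  rw [measure_sequenceRelay hlam hX hH MeasurableSet.univ (subset_univ _)
    (fun A hA _ => hvoid A hA) hβ hG0 (hG β hβ) hd]
  refine setLIntegral_congr_fun measurableSet_Ioi fun t ht => ?_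
  rw [intensity_lt_fallRatio_univ α β d ht]

/-- Ignoring the buildings outside `J` only makes relaying more likely, and discarding the distances
up to `δ` loses at most `δ`, since probabilities are at most 1. -/
theorem le_lintegral_relayLength (hlam : 0 < lam) (hX : ∀ i, Measurable (X i))
    (hH : ∀ i, Measurable (H i)) (hJ : MeasurableSet J) (hαJ : Ioi α ⊆ J)
    (hvoid : ∀ A : Set (ℝ × ℝ), MeasurableSet A → (∀ p ∈ A, p.1 ∈ J) →
      Q {ω | ∀ i, (X i ω, H i ω) ∉ A} = expNeg (ENNReal.ofReal lam * (volume.prod ν) A))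
    (hβ : 0 ≤ β) (hG0 : tailIntegral ν β ≠ 0) (hG : ∀ u, 0 ≤ u → tailIntegral ν u ≠ ⊤) {δ : ℝ}
    (hδ : 0 ≤ δ) :
    (ENNReal.ofReal lam)⁻¹ * ∫⁻ u in Ioo 0 β, tailIntegral ν β / tailIntegral ν u ^ 2 ≤
      ENNReal.ofReal δ + ∫⁻ ω, relayLength J α δ β (fun i => X i ω) (fun i => H i ω) ∂Q := by
  rw [lintegral_relayLength hX hH hJ δ, ← lintegral_lintegral_expNeg_tailIntegral hlam hβ hG0 hG]
  have h1 : ∀ d ∈ Ioi (0 : ℝ), ∫⁻ t in Ioi (0 : ℝ), (ENNReal.ofReal lam * tailIntegral ν β) *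
        expNeg (ENNReal.ofReal lam * tailIntegral ν β * ENNReal.ofReal t) *
        (Ici (d / t)).indicator 1 β * expNeg (ENNReal.ofReal lam *
          (ENNReal.ofReal t * ∫⁻ v in Ioo (β - d / t) β, ν (Ioi v))) ≤
      Q {ω | SequenceRelay J α β d (fun i => X i ω) (fun i => H i ω)} := by
    intro d hd
    rw [measure_sequenceRelay hlam hX hH hJ hαJ hvoid hβ hG0 (hG β hβ) hd]
    refine setLIntegral_mono' measurableSet_Ioi fun t ht => ?_
    gcongr
    exact antitone_expNeg (mul_le_mul_right (intensity_lt_fallRatio_le J α β d ht) _)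
  refine (setLIntegral_mono' measurableSet_Ioi h1).trans ?_
  rw [← Ioc_union_Ioi_eq_Ioi hδ, lintegral_union measurableSet_Ioi
    (Set.disjoint_left.2 fun x hx hx' => not_lt.2 hx.2 hx')]
  gcongr
  refine (setLIntegral_mono' measurableSet_Ioc fun d _ => prob_le_one).trans ?_
  simp

end ExpectedLength

/-! ### Divergence of the mean length under the height distribution -/

section Divergence

variable {ν : Measure ℝ}

theorem exists_measure_Ioi_add_ne_zero {u : ℝ} (hu : ν (Ioi u) ≠ 0) :
    ∃ ε > 0, ν (Ioi (u + ε)) ≠ 0 := by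
  by_contra! hcon
  refine hu ?_
  have e : Ioi u = ⋃ n : ℕ, Ioi (u + 1 / ((n : ℝ) + 1)) := by
    ext x
    simp only [mem_Ioi, mem_iUnion]
    constructor
    · intro hx
      obtain ⟨n, hn⟩ := exists_nat_one_div_lt (sub_pos.2 hx)
      exact ⟨n, by linarith⟩
    · rintro ⟨n, hn⟩
      have : (0 : ℝ) < 1 / ((n : ℝ) + 1) := by positivity
      linarith
  rw [e, measure_iUnion_null_iff]
  exact fun n => hcon _ (by positivity)

theorem tailIntegral_ne_zero {u : ℝ} (hu : ν (Ioi u) ≠ 0) : tailIntegral ν u ≠ 0 := by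
  obtain ⟨ε, hε, h⟩ := exists_measure_Ioi_add_ne_zero hu
  have h1 : ENNReal.ofReal ε * ν (Ioi (u + ε)) ≤ tailIntegral ν u := by
    calc ENNReal.ofReal ε * ν (Ioi (u + ε)) = ∫⁻ _ in Ioc u (u + ε), ν (Ioi (u + ε)) := by
          rw [setLIntegral_const, Real.volume_Ioc, add_sub_cancel_left, mul_comm]
      _ ≤ ∫⁻ x in Ioc u (u + ε), ν (Ioi x) :=
          setLIntegral_mono' measurableSet_Ioc fun x hx => measure_mono (Ioi_subset_Ioi hx.2)
      _ ≤ tailIntegral ν u := lintegral_mono_set Ioc_subset_Ioi_self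
  intro h0
  rw [h0] at h1
  exact mul_ne_zero (by simpa using hε) h (le_antisymm h1 zero_le)

/-- The integrand `ν (Ioi x)` decreases, so on (u, v] it is at most its value at `u`. -/
theorem tailIntegral_le_add {u v : ℝ} (huv : u ≤ v) :
    tailIntegral ν u ≤ tailIntegral ν v + ENNReal.ofReal (v - u) * ν (Ioi u) := by
  have h : tailIntegral ν u = (∫⁻ x in Ioc u v, ν (Ioi x)) + tailIntegral ν v := by
    rw [tailIntegral, ← Ioc_union_Ioi_eq_Ioi huv, lintegral_union measurableSet_Ioi
      (Set.disjoint_left.2 fun x hx hx' => not_lt.2 hx.2 hx')]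
    rfl
  rw [h, add_comm]
  refine add_le_add le_rfl ?_
  calc ∫⁻ x in Ioc u v, ν (Ioi x) ≤ ∫⁻ _ in Ioc u v, ν (Ioi u) :=
        setLIntegral_mono' measurableSet_Ioc fun x hx => measure_mono (Ioi_subset_Ioi hx.1.le)
    _ = _ := by rw [setLIntegral_const, Real.volume_Ioc, mul_comm]

theorem integral_inv_sq_affine {a c M β : ℝ} (ha : 0 < a) (hc : 0 < c) (hM : M ≤ β) :
    ∫ u in M..β, ((a + c * (β - u)) ^ 2)⁻¹ = c⁻¹ * (a⁻¹ - (a + c * (β - M))⁻¹) ∧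
      IntervalIntegrable (fun u => ((a + c * (β - u)) ^ 2)⁻¹) volume M β := by
  have hpos : ∀ u ∈ uIcc M β, 0 < a + c * (β - u) := by
    intro u hu
    rw [uIcc_of_le hM] at hu
    have := mul_nonneg hc.le (sub_nonneg.2 hu.2)
    linarith
  have hint : IntervalIntegrable (fun u => ((a + c * (β - u)) ^ 2)⁻¹) volume M β := by
    refine ContinuousOn.intervalIntegrable (ContinuousOn.inv₀ (by fun_prop) fun u hu => ?_)
    exact (pow_pos (hpos u hu) 2).ne'
  refine ⟨?_, hint⟩
  have hd : ∀ u ∈ uIcc M β, HasDerivAt (fun u => c⁻¹ * (a + c * (β - u))⁻¹)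
      ((a + c * (β - u)) ^ 2)⁻¹ u := by
    intro u hu
    have h := (((((hasDerivAt_id u).const_sub β).const_mul c).const_add a).inv
      (hpos u hu).ne').const_mul c⁻¹
    refine h.congr_deriv ?_
    field_simp
    simp
  rw [intervalIntegral.integral_eq_sub_of_hasDerivAt hd hint]
  simp; ring

/-- On [M, β], G is at most the affine function `a + c * (β - u)` with `a = G(β)` and `c = ν (Ioi
M)`. Putting this function in place of G lowers both terms, and turns the right-hand side into
exactly 1. -/
theorem one_le_mul_lintegral_inv_sq [IsProbabilityMeasure ν]
    (hG : ∀ u, 0 ≤ u → tailIntegral ν u ≠ ⊤) {M β : ℝ} (hM : 0 ≤ M) (hMβ : M < β)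
    (hβ : ν (Ioi β) ≠ 0) :
    1 ≤ ν (Ioi M) * (∫⁻ u in Ioo M β, tailIntegral ν β / tailIntegral ν u ^ 2) +
      tailIntegral ν β / tailIntegral ν M := by
  have hpM : ν (Ioi M) ≠ 0 := fun h => hβ (measure_mono_null (Ioi_subset_Ioi hMβ.le) h)
  obtain ⟨a, ha⟩ : ∃ a, a = (tailIntegral ν β).toReal := ⟨_, rfl⟩
  obtain ⟨c, hc⟩ : ∃ c, c = (ν (Ioi M)).toReal := ⟨_, rfl⟩
  have ha0 : 0 < a := ha ▸ ENNReal.toReal_pos (tailIntegral_ne_zero hβ) (hG β (hM.trans hMβ.le))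
  have hc0 : 0 < c := hc ▸ ENNReal.toReal_pos hpM (measure_ne_top _ _)
  have hGa : tailIntegral ν β = ENNReal.ofReal a := by
    rw [ha, ENNReal.ofReal_toReal (hG β (hM.trans hMβ.le))]
  have hpc : ν (Ioi M) = ENNReal.ofReal c := by rw [hc, ENNReal.ofReal_toReal (measure_ne_top _ _)]
  have hbound : ∀ u ∈ Icc M β, tailIntegral ν u ≤ ENNReal.ofReal (a + c * (β - u)) := by
    intro u hu
    refine (tailIntegral_le_add hu.2).trans ?_
    rw [hGa, ENNReal.ofReal_add ha0.le (mul_nonneg hc0.le (sub_nonneg.2 hu.2)), mul_comm c,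
      ENNReal.ofReal_mul (sub_nonneg.2 hu.2), ← hpc]
    gcongr
    exact hu.1
  have hpos : ∀ u ∈ Icc M β, 0 < a + c * (β - u) := fun u hu => by
    have := mul_nonneg hc0.le (sub_nonneg.2 hu.2)
    linarith
  obtain ⟨hval, hint⟩ := integral_inv_sq_affine ha0 hc0 hMβ.le
  have h1 : ENNReal.ofReal (a * (c⁻¹ * (a⁻¹ - (a + c * (β - M))⁻¹))) ≤
      ∫⁻ u in Ioo M β, tailIntegral ν β / tailIntegral ν u ^ 2 := by
    have hi : IntegrableOn (fun u => a * ((a + c * (β - u)) ^ 2)⁻¹) (Ioo M β) :=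
      (((intervalIntegrable_iff_integrableOn_Ioc_of_le hMβ.le).1 hint).mono_set
        Ioo_subset_Ioc_self).const_mul a
    rw [← hval, ← intervalIntegral.integral_const_mul, intervalIntegral.integral_of_le hMβ.le,
      integral_Ioc_eq_integral_Ioo,
      ofReal_integral_eq_lintegral_ofReal hi (ae_of_all _ fun u => by positivity)]
    refine setLIntegral_mono' measurableSet_Ioo fun u hu => ?_
    have hu' := Ioo_subset_Icc_self hu
    rw [ENNReal.ofReal_mul ha0.le, ENNReal.ofReal_inv_of_pos (pow_pos (hpos u hu') 2),
      ENNReal.ofReal_pow (hpos u hu').le, hGa, div_eq_mul_inv]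
    gcongr
    exact hbound u hu'
  have h2 : ENNReal.ofReal (a / (a + c * (β - M))) ≤ tailIntegral ν β / tailIntegral ν M := by
    have hM' : M ∈ Icc M β := ⟨le_rfl, hMβ.le⟩
    rw [ENNReal.ofReal_div_of_pos (hpos M hM'), hGa]
    gcongr
    exact hbound M hM'
  refine le_trans ?_ (add_le_add (mul_le_mul_right h1 _) h2)
  have hA : 0 < a + c * (β - M) := hpos M ⟨le_rfl, hMβ.le⟩
  have hinv : (a + c * (β - M))⁻¹ ≤ a⁻¹ := by
    gcongr
    have := mul_nonneg hc0.le (sub_nonneg.2 hMβ.le)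
    linarith
  have h3 : 0 ≤ a * (c⁻¹ * (a⁻¹ - (a + c * (β - M))⁻¹)) :=
    mul_nonneg ha0.le (mul_nonneg (inv_nonneg.2 hc0.le) (sub_nonneg.2 hinv))
  rw [hpc, ← ENNReal.ofReal_mul hc0.le, ← ENNReal.ofReal_add (mul_nonneg hc0.le h3)
    (div_nonneg ha0.le hA.le), ← ENNReal.ofReal_one]
  refine ENNReal.ofReal_le_ofReal (le_of_eq ?_)
  field_simp
  ring

/-- The mean length of the part at height more than `M`, as an integral over the heights. -/
noncomputable def tailMeanLength (ν : Measure ℝ) (M : ℝ) : ENNReal :=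
  ∫⁻ β in Ioi M, ∫⁻ u in Ioo M β, tailIntegral ν β / tailIntegral ν u ^ 2 ∂volume ∂ν

/-- Exchanging the integrals over `M < u < β` displays the tail as the integral over (M, ∞) of a
density not depending on `M`. -/
theorem tailMeanLength_eq [IsProbabilityMeasure ν] (M : ℝ) :
    tailMeanLength ν M = ∫⁻ u in Ioi M,
      (∫⁻ β in Ioi u, tailIntegral ν β ∂ν) / tailIntegral ν u ^ 2 := by
  have hGm : Measurable (tailIntegral ν) := antitone_tailIntegral.measurable
  have hS : MeasurableSet {p : ℝ × ℝ | p.2 < p.1} := measurableSet_lt measurable_snd measurable_fst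
  let f : ℝ × ℝ → ENNReal := {p : ℝ × ℝ | p.2 < p.1}.indicator
    fun p => tailIntegral ν p.1 / tailIntegral ν p.2 ^ 2
  have hf : Measurable f := Measurable.indicator
    ((hGm.comp measurable_fst).div ((hGm.comp measurable_snd).pow_const 2)) hS
  have h1 : tailMeanLength ν M = ∫⁻ β in Ioi M, ∫⁻ u in Ioi M, f (β, u) ∂volume ∂ν := by
    refine setLIntegral_congr_fun measurableSet_Ioi fun β hβ => ?_
    have e : ∀ u, f (β, u) = (Iio β).indicator
        (fun u => tailIntegral ν β / tailIntegral ν u ^ 2) u := fun u => rfl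
    simp only [e]
    rw [setLIntegral_indicator measurableSet_Iio, inter_comm, Ioi_inter_Iio]
  rw [h1, lintegral_lintegral_swap (f := fun β u => f (β, u)) hf.aemeasurable]
  refine setLIntegral_congr_fun measurableSet_Ioi fun u hu => ?_
  have hu : M < u := hu
  have e : ∀ β, f (β, u) = (Ioi u).indicator
      (fun β => tailIntegral ν β * (tailIntegral ν u ^ 2)⁻¹) β := fun β => rfl
  simp only [e]
  rw [setLIntegral_indicator measurableSet_Ioi, inter_eq_left.2 (Ioi_subset_Ioi hu.le),
    lintegral_mul_const _ hGm, div_eq_mul_inv]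

theorem tailMeanLength_antitone [IsProbabilityMeasure ν] : Antitone (tailMeanLength ν) := by
  intro M N h
  rw [tailMeanLength_eq, tailMeanLength_eq]
  exact lintegral_mono_set (Ioi_subset_Ioi h)

/-- Integration of `one_le_mul_lintegral_inv_sq` over the heights above `M`; enlarging the sum to
all of them is legitimate because almost every height can be exceeded. -/
theorem measure_Ioi_le [IsProbabilityMeasure ν] (hG : ∀ u, 0 ≤ u → tailIntegral ν u ≠ ⊤)
    (hW : ∀ᵐ h ∂ν, ν (Ioi h) ≠ 0) {M : ℝ} (hM : 0 ≤ M) :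
    ν (Ioi M) ≤ ν (Ioi M) * tailMeanLength ν M +
      (∫⁻ β in Ioi M, tailIntegral ν β ∂ν) / tailIntegral ν M := by
  have hGm : Measurable (tailIntegral ν) := antitone_tailIntegral.measurable
  calc ν (Ioi M) = ∫⁻ _ in Ioi M, 1 ∂ν := by simp
    _ ≤ ∫⁻ β in Ioi M, (ν (Ioi M) * (∫⁻ u in Ioo M β, tailIntegral ν β / tailIntegral ν u ^ 2) +
      tailIntegral ν β / tailIntegral ν M) ∂ν := by
        refine lintegral_mono_ae ?_
        filter_upwards [ae_restrict_of_ae hW, ae_restrict_mem measurableSet_Ioi] with β h1 h2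
        exact one_le_mul_lintegral_inv_sq hG hM h2 h1
    _ = _ := by
        simp only [div_eq_mul_inv]
        rw [lintegral_add_right _ (hGm.mul_const _), lintegral_mul_const _ hGm,
          lintegral_const_mul' _ _ (measure_ne_top _ _)]
        rfl

/-- If the tail at `M` were below 1/2, so would be every later one, and `measure_Ioi_le` would give
`∫ G dν ≥ G(u) ν (Ioi u) / 2` over the heights above each `u > M`. The density is then at least `ν
(Ioi u) / (2 G(u)) ≥ ν (Ioi u) / (2 G(M))`, whose integral beyond `M` is 1/2: a contradiction. -/
theorem half_le_tailMeanLength [IsProbabilityMeasure ν]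
    (hG : ∀ u, 0 ≤ u → tailIntegral ν u ≠ ⊤)
    (hW : ∀ᵐ h ∂ν, ν (Ioi h) ≠ 0) {M : ℝ} (hM : 0 ≤ M) (hpM : ν (Ioi M) ≠ 0) :
    2⁻¹ ≤ tailMeanLength ν M := by
  by_contra! hlt
  refine absurd hlt (not_lt.2 ?_)
  have hG0 := tailIntegral_ne_zero hpM
  have hhalf : ∀ u ∈ Ioi M, 2⁻¹ * ν (Ioi u) ≤
      (∫⁻ β in Ioi u, tailIntegral ν β ∂ν) / tailIntegral ν u := by
    intro u hu
    have hu : M < u := hu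
    have h1 := measure_Ioi_le hG hW (hM.trans hu.le)
    have h2 : ν (Ioi u) * tailMeanLength ν u ≤ ν (Ioi u) * 2⁻¹ :=
      mul_le_mul_right ((tailMeanLength_antitone hu.le).trans hlt.le) _
    have h3 := h1.trans (add_le_add h2 le_rfl)
    have h4 : ν (Ioi u) = ν (Ioi u) * 2⁻¹ + 2⁻¹ * ν (Ioi u) := by
      rw [mul_comm, ← add_mul, ENNReal.inv_two_add_inv_two, one_mul]
    have h5 : ν (Ioi u) * 2⁻¹ ≠ ⊤ := ENNReal.mul_ne_top (measure_ne_top _ _) (by simp)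
    exact (ENNReal.add_le_add_iff_left h5).1 (h4 ▸ h3)
  rw [tailMeanLength_eq]
  calc (2⁻¹ : ENNReal) = 2⁻¹ * ((tailIntegral ν M)⁻¹ * tailIntegral ν M) := by
        rw [ENNReal.inv_mul_cancel hG0 (hG M hM), mul_one]
    _ = ∫⁻ u in Ioi M, 2⁻¹ * ((tailIntegral ν M)⁻¹ * ν (Ioi u)) := by
        rw [lintegral_const_mul' _ _ (by simp), lintegral_const_mul' _ _ (ENNReal.inv_ne_top.2 hG0)]
        rfl
    _ ≤ _ := by
        refine setLIntegral_mono' measurableSet_Ioi fun u hu => ?_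
        have hu' : M < u := hu
        calc 2⁻¹ * ((tailIntegral ν M)⁻¹ * ν (Ioi u))
            = (tailIntegral ν M)⁻¹ * (2⁻¹ * ν (Ioi u)) := by ring
          _ ≤ (tailIntegral ν u)⁻¹ *
              ((∫⁻ β in Ioi u, tailIntegral ν β ∂ν) / tailIntegral ν u) := by
              gcongr
              · exact antitone_tailIntegral hu'.le
              · exact hhalf u hu
          _ = _ := by
              rw [div_eq_mul_inv, div_eq_mul_inv, sq, ENNReal.mul_inv (Or.inr (hG u (hM.trans hu'.le)))
                (Or.inl (hG u (hM.trans hu'.le)))]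
              ring

/-- If it were finite, the tails would tend to 0 as `M` increases to the top of the support, by
continuity from above of the measure `η`. They stay at least 1/2. -/
theorem tailMeanLength_zero_eq_top [IsProbabilityMeasure ν] (hν : ν (Iio 0) = 0)
    (hG : ∀ u, 0 ≤ u → tailIntegral ν u ≠ ⊤) (hW : ∀ᵐ h ∂ν, ν (Ioi h) ≠ 0) :
    tailMeanLength ν 0 = ⊤ := by
  by_contra hfin
  have hp0 : ν (Ioi 0) ≠ 0 := by
    intro h0
    have h1 : ∀ᵐ h ∂ν, 0 ≤ h := by
      rw [ae_iff]; simp only [not_le]; exact hν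
    obtain ⟨h, h2, h3⟩ := (hW.and h1).exists
    exact h2 (measure_mono_null (Ioi_subset_Ioi h3) h0)
  let φ : ℝ → ENNReal := fun u => (∫⁻ β in Ioi u, tailIntegral ν β ∂ν) / tailIntegral ν u ^ 2
  have hφ0 : ∀ u, ν (Ioi u) = 0 → φ u = 0 := by
    intro u hu
    simp only [φ]
    rw [Measure.restrict_eq_zero.2 hu, lintegral_zero_measure, ENNReal.zero_div]
  let η : Measure ℝ := volume.withDensity φ
  have hη : ∀ M, η (Ioi M) = tailMeanLength ν M := fun M => by
    rw [tailMeanLength_eq, withDensity_apply _ measurableSet_Ioi]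
  obtain ⟨M, hMmono, hM0, hMp, hMη⟩ : ∃ M : ℕ → ℝ, Monotone M ∧ (∀ n, 0 ≤ M n) ∧
      (∀ n, ν (Ioi (M n)) ≠ 0) ∧ η (⋂ n, Ioi (M n)) = 0 := by
    -- For bounded heights, `M n` increases strictly below the top `S` of the support; otherwise `M
    -- n = n`.
    by_cases hex : ∃ s, ν (Ioi s) = 0
    · have hbdd : BddBelow {s | ν (Ioi s) = 0} :=
        ⟨0, fun s hs => le_of_lt (by
          by_contra! h
          exact hp0 (measure_mono_null (Ioi_subset_Ioi h) hs))⟩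
      have hlt : ∀ u, ν (Ioi u) ≠ 0 → u < sInf {s | ν (Ioi s) = 0} := by
        intro u hu
        obtain ⟨ε, hε, h⟩ := exists_measure_Ioi_add_ne_zero hu
        refine (lt_add_of_pos_right u hε).trans_le (le_csInf hex fun s hs => ?_)
        by_contra! h'
        exact h (measure_mono_null (Ioi_subset_Ioi h'.le) hs)
      set S := sInf {s | ν (Ioi s) = 0}
      have hS : 0 < S := hlt 0 hp0
      have hfrac : ∀ n : ℕ, S - S * (1 / ((n : ℝ) + 1)) < S := fun n =>
        sub_lt_self _ (by positivity)
      refine ⟨fun n => S - S * (1 / ((n : ℝ) + 1)), fun m n hmn => ?_, fun n => ?_, fun n h => ?_, ?_⟩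
      · have : (m : ℝ) ≤ n := by exact_mod_cast hmn
        simp only
        gcongr
      · have h1 : 1 / ((n : ℝ) + 1) ≤ 1 := by
          rw [div_le_one (by positivity)]
          linarith [Nat.cast_nonneg (α := ℝ) n]
        simp only
        linarith [mul_le_mul_of_nonneg_left h1 hS.le]
      · exact absurd (csInf_le hbdd h) (not_le.2 (hfrac n))
      · have hsub : (⋂ n : ℕ, Ioi (S - S * (1 / ((n : ℝ) + 1)))) ⊆ Ici S := by
          intro u hu
          rw [mem_Ici]
          by_contra! h
          obtain ⟨n, hn⟩ := exists_nat_one_div_lt (div_pos (sub_pos.2 h) hS)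
          have h1 := mem_iInter.1 hu n
          rw [mem_Ioi] at h1
          rw [lt_div_iff₀ hS] at hn
          linarith
        -- The density of `η` vanishes beyond `S`, and the point `S` itself is Lebesgue null.
        refine measure_mono_null hsub ?_
        rw [withDensity_apply _ measurableSet_Ici, setLIntegral_congr Ioi_ae_eq_Ici.symm]
        refine setLIntegral_eq_zero measurableSet_Ioi fun u hu => hφ0 u ?_
        by_contra h
        exact lt_asymm (hlt u h) hu
    · push Not at hex
      refine ⟨fun n => n, Nat.mono_cast, fun n => Nat.cast_nonneg n, fun n => hex _, ?_⟩
      refine measure_mono_null (fun u hu => ?_) measure_empty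
      obtain ⟨n, hn⟩ := exists_nat_ge u
      exact absurd (mem_iInter.1 hu n) (not_lt.2 hn)
  have hlim := tendsto_measure_iInter_atTop (μ := η) (s := fun n => Ioi (M n))
    (fun n => measurableSet_Ioi.nullMeasurableSet) (fun m n hmn => Ioi_subset_Ioi (hMmono hmn))
    ⟨0, ((hη _).trans_le (tailMeanLength_antitone (hM0 0))).trans_lt (lt_top_iff_ne_top.2 hfin) |>.ne⟩
  rw [hMη] at hlim
  have hge := ge_of_tendsto' hlim fun n =>
    (half_le_tailMeanLength hG hW (hM0 n) (hMp n)).trans_eq (hη _).symm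
  simp at hge

end Divergence

/-! ### The tail primitive -/

/-- By the layer cake formula, G(0) is the mean height. -/
theorem tailIntegral_ne_top {ν : Measure ℝ} (hν : ν (Iio 0) = 0)
    (hmean : Integrable (fun h : ℝ => h) ν) {u : ℝ} (hu : 0 ≤ u) : tailIntegral ν u ≠ ⊤ := by
  have h0 : 0 ≤ᵐ[ν] fun h : ℝ => h := by
    rw [Filter.EventuallyLE, ae_iff]; simp only [Pi.zero_apply, not_le]; exact hν
  have h1 := lintegral_eq_lintegral_meas_lt ν h0 measurable_id.aemeasurable
  have h2 : tailIntegral ν 0 = ∫⁻ h, ENNReal.ofReal h ∂ν := h1.symm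
  refine ((antitone_tailIntegral hu).trans_lt ?_).ne
  rw [h2]
  refine lt_of_le_of_lt (lintegral_mono fun h => ?_) hmean.2
  exact Real.ofReal_le_enorm h

theorem tailPrimitive_eq {ν : Measure ℝ} [IsProbabilityMeasure ν] (u : ℝ) :
    tailPrimitive ν u = -(tailIntegral ν u).toReal := by
  have h : ∀ x, 1 - cdf ν x = (ν (Ioi x)).toReal := fun x => by
    rw [cdf_eq_real, ← compl_Iic, ← Measure.real, probReal_compl_eq_one_sub measurableSet_Iic]
  simp only [tailPrimitive, h]
  rw [integral_toReal measurable_measure_Ioi.aemeasurable (ae_of_all _ fun x => measure_lt_top _ _)]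
  rfl

theorem intervalIntegrable_tailPrimitive_ratio {ν : Measure ℝ} [IsProbabilityMeasure ν]
    (hG : ∀ u, 0 ≤ u → tailIntegral ν u ≠ ⊤) {lam β : ℝ} (hlam : 0 < lam) (hβ : 0 ≤ β)
    (hG0 : tailIntegral ν β ≠ 0) :
    IntervalIntegrable (fun u => -(1 / lam) * (tailPrimitive ν β / tailPrimitive ν u ^ 2))
        volume 0 β ∧
      ENNReal.ofReal
          (∫ u in (0 : ℝ)..β, -(1 / lam) * (tailPrimitive ν β / tailPrimitive ν u ^ 2)) =
        (ENNReal.ofReal lam)⁻¹ * ∫⁻ u in Ioo 0 β, tailIntegral ν β / tailIntegral ν u ^ 2 := by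
  have hpos : ∀ u ∈ Icc 0 β, 0 < (tailIntegral ν u).toReal := fun u hu =>
    ENNReal.toReal_pos (fun h => hG0 (le_antisymm ((antitone_tailIntegral hu.2).trans_eq h) zero_le))
      (hG u hu.1)
  have e : ∀ u, -(1 / lam) * (tailPrimitive ν β / tailPrimitive ν u ^ 2) =
      lam⁻¹ * ((tailIntegral ν β).toReal / (tailIntegral ν u).toReal ^ 2) := fun u => by
    rw [tailPrimitive_eq, tailPrimitive_eq]; ring
  simp only [e]
  have hint : IntervalIntegrable
      (fun u => lam⁻¹ * ((tailIntegral ν β).toReal / (tailIntegral ν u).toReal ^ 2)) volume 0 β := by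
    -- G decreases and remains at least G(β) > 0, so the integrand increases on [0, β].
    refine MonotoneOn.intervalIntegrable fun u hu v hv huv => ?_
    rw [uIcc_of_le hβ] at hu hv
    have h1 := ENNReal.toReal_mono (hG u hu.1) (antitone_tailIntegral (ν := ν) huv)
    have h2 := hpos v hv
    gcongr
  refine ⟨hint, ?_⟩
  have hi := ((intervalIntegrable_iff_integrableOn_Ioc_of_le hβ).1 hint).mono_set
    (Ioo_subset_Ioc_self : Ioo 0 β ⊆ Ioc 0 β)
  rw [intervalIntegral.integral_of_le hβ, integral_Ioc_eq_integral_Ioo,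
    ofReal_integral_eq_lintegral_ofReal hi (ae_of_all _ fun u => by positivity),
    ← lintegral_const_mul' _ _ (ENNReal.inv_ne_top.2 (by simpa using hlam))]
  refine setLIntegral_congr_fun measurableSet_Ioo fun u hu => ?_
  have hu' := Ioo_subset_Icc_self hu
  rw [ENNReal.ofReal_mul (inv_nonneg.2 hlam.le), ENNReal.ofReal_inv_of_pos hlam,
    ENNReal.ofReal_div_of_pos (pow_pos (hpos u hu') 2), ENNReal.ofReal_pow ENNReal.toReal_nonneg,
    ENNReal.ofReal_toReal (hG β hβ), ENNReal.ofReal_toReal (hG u hu'.1)]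

theorem measure_Ioi_ne_zero_of_lt_heightSup {ν : Measure ℝ} {β : ℝ}
    (h : (β : EReal) < heightSup ν) : ν (Ioi β) ≠ 0 := by
  obtain ⟨_, ⟨x, hx, rfl⟩, hlt⟩ := lt_sSup_iff.1 h
  have hβx : β < x := EReal.coe_lt_coe_iff.1 hlt
  exact ((Measure.mem_support_iff_forall x).1 hx _ (Ioi_mem_nhds hβx)).ne'

theorem measure_Ioi_eq_zero_of_heightSup_le {ν : Measure ℝ} {β : ℝ}
    (h : heightSup ν ≤ (β : EReal)) : ν (Ioi β) = 0 := by
  refine measure_mono_null (t := ν.supportᶜ) (fun x hx hxs => ?_) Measure.measure_compl_support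
  have h1 : (x : EReal) ≤ β := (le_sSup (mem_image_of_mem _ hxs)).trans h
  exact not_lt.2 (EReal.coe_le_coe_iff.1 h1) hx

/-! ### The zone in terms of the sequence of buildings -/

/-- Right buildings not higher than `β` impose nothing: slopes leaving towards them are nonpositive,
while those arriving are nonnegative. -/
theorem SequenceRelay.relayCondition {α β d : ℝ} (hβ : 0 ≤ β) {x h : ℕ → ℝ}
    (hr : SequenceRelay univ α β d x h) :
    RelayCondition (insert (α, β) (range fun i => (x i, h i))) (α, β) (α - d, 0) := by
  obtain ⟨hd, hle, hk⟩ := hr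
  refine ⟨by simpa using hd, ?_⟩
  rintro c (rfl | ⟨k, rfl⟩) hc q hq hqb
  · exact absurd hc (lt_irrefl _)
  have hc' : 0 < x k - α := sub_pos.2 hc
  have hq' : 0 < α - q.1 := sub_pos.2 hqb
  rcases hq with rfl | ⟨rfl | ⟨j, rfl⟩, hdq⟩
  · rcases le_or_gt (h k) β with hkβ | hkβ
    · exact (mul_nonpos_of_nonpos_of_nonneg (sub_nonpos.2 hkβ) hq'.le).trans
        (mul_nonneg (by simpa using hβ) hc'.le)
    · simpa using (hk k hc hkβ).1
  · exact absurd hqb (lt_irrefl _)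
  · rcases le_or_gt (h k) β with hkβ | hkβ
    · exact (mul_nonpos_of_nonpos_of_nonneg (sub_nonpos.2 hkβ) hq'.le).trans
        (mul_nonneg (sub_nonneg.2 (hle j (mem_univ _) hdq hqb)) hc'.le)
    · exact (hk k hc hkβ).2 j (mem_univ _) hdq hqb

/-- A higher building on the right forces every arriving slope to be positive, hence the
intermediate buildings to be no higher than `β`. -/
theorem RelayCondition.sequenceRelay {α β d : ℝ} {x h : ℕ → ℝ}
    (hex : ∃ k, α < x k ∧ β < h k)
    (hr : RelayCondition (insert (α, β) (range fun i => (x i, h i))) (α, β) (α - d, 0)) :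
    SequenceRelay univ α β d x h := by
  obtain ⟨hd, hr⟩ := hr
  have hmem : ∀ k, (x k, h k) ∈ insert (α, β) (range fun i => (x i, h i)) := fun k =>
    mem_insert_of_mem _ ⟨k, rfl⟩
  have hd' : 0 < d := by simpa using hd
  have hpair : ∀ k, α < x k → ∀ j, α - d < x j → x j < α →
      (h k - β) * (α - x j) ≤ (β - h j) * (x k - α) := fun k hk j hj hj' =>
    hr _ (hmem k) hk _ (Or.inr ⟨hmem j, hj⟩) hj'
  refine ⟨hd', fun j _ hj hj' => ?_, fun k hk hkβ => ⟨?_, fun j _ hj hj' => hpair k hk j hj hj'⟩⟩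
  · obtain ⟨k, hk, hkβ⟩ := hex
    have h1 : 0 < (h k - β) * (α - x j) := mul_pos (sub_pos.2 hkβ) (sub_pos.2 hj')
    exact (sub_pos.1 (pos_of_mul_pos_left (h1.trans_le (hpair k hk j hj hj')) (sub_pos.2 hk).le)).le
  · simpa using hr _ (hmem k) hk _ (Or.inl rfl) hd

theorem zoneLength_insert_range {α β : ℝ} (hβ : 0 ≤ β) {x h : ℕ → ℝ} (hα : ∀ i, x i ≠ α)
    (hfin : ∀ n : ℕ, {i | x i ∈ Icc (-(n : ℝ)) n}.Finite) :
    zoneLength (insert (α, β) (range fun i => (x i, h i))) (α, β) =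
      volume {d | RelayCondition (insert (α, β) (range fun i => (x i, h i))) (α, β) (α - d, 0)} := by
  refine zoneLength_eq (mem_insert _ _) hβ ?_ fun z => ?_
  · rintro c (rfl | ⟨i, rfl⟩) hc
    · rfl
    · exact absurd hc (hα i)
  · obtain ⟨n, hn⟩ := exists_nat_ge (max (-z) α)
    refine (((hfin n).image fun i => (x i, h i)).insert (α, β)).subset ?_
    rintro q ⟨rfl | ⟨i, rfl⟩, hz, hq⟩
    · exact mem_insert _ _
    · refine mem_insert_of_mem _ ⟨i, ⟨?_, ?_⟩, rfl⟩
      · linarith [(le_max_left (-z) α).trans hn, hz.le]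
      · exact hq.trans ((le_max_right _ _).trans hn)

/-- Without a building above `β`, all constraints hold at every distance. -/
theorem relayLength_eq_top {J : Set ℝ} {α δ β : ℝ} {x h : ℕ → ℝ} (hh : ∀ i, h i ≤ β) :
    relayLength J α δ β x h = ⊤ := by
  have hsub : Ioi (max δ 0) ⊆ {d | δ < d ∧ SequenceRelay J α β d x h} := fun d hd =>
    ⟨(le_max_left _ _).trans_lt hd, (le_max_right _ _).trans_lt hd, fun j _ _ _ => hh j,
      fun k _ hk => absurd hk (not_lt.2 (hh k))⟩
  refine top_le_iff.1 (le_trans ?_ (measure_mono hsub))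
  simp

theorem relayLength_le_zoneLength {α β : ℝ} (hβ : 0 ≤ β) {x h : ℕ → ℝ} (hα : ∀ i, x i ≠ α)
    (hfin : ∀ n : ℕ, {i | x i ∈ Icc (-(n : ℝ)) n}.Finite) :
    relayLength univ α 0 β x h ≤ zoneLength (insert (α, β) (range fun i => (x i, h i))) (α, β) := by
  rw [zoneLength_insert_range hβ hα hfin]
  exact measure_mono fun d hd => hd.2.relayCondition hβ

theorem zoneLength_eq_relayLength {α β : ℝ} (hβ : 0 ≤ β) {x h : ℕ → ℝ} (hα : ∀ i, x i ≠ α)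
    (hfin : ∀ n : ℕ, {i | x i ∈ Icc (-(n : ℝ)) n}.Finite) (hex : ∃ k, α < x k ∧ β < h k) :
    zoneLength (insert (α, β) (range fun i => (x i, h i))) (α, β) = relayLength univ α 0 β x h := by
  refine le_antisymm ?_ (relayLength_le_zoneLength hβ hα hfin)
  rw [zoneLength_insert_range hβ hα hfin]
  exact measure_mono fun d hd => ⟨(hd.sequenceRelay hex).1, hd.sequenceRelay hex⟩

/-! ### Almost sure properties of the landscape. -/

section AlmostSure

variable {Ω : Type*} [MeasurableSpace Ω] {P : Measure Ω} [IsProbabilityMeasure P] {lam : ℝ}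
  {X H : ℕ → Ω → ℝ} {ν : Measure ℝ}

theorem IsPoissonPointProcess.ae_finite (hX : IsPoissonPointProcess P lam X) (hlam : 0 < lam) :
    ∀ᵐ ω ∂P, ∀ n : ℕ, {i | X i ω ∈ Icc (-(n : ℝ)) n}.Finite := by
  refine ae_all_iff.2 fun n => ?_
  filter_upwards [hX.ae_pointCount_ne_top hlam (measurableSet_Icc (a := -(n : ℝ)) (b := n))
    (by simp)] with ω hω
  exact encard_ne_top_iff.1 hω

theorem IsPoissonPointProcess.measure_forall_notMem
    (hX : IsPoissonPointProcess P lam X) (hlam : 0 < lam) (hH : ∀ i, Measurable (H i))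
    (hν : ∀ i, P.map (H i) = ν) (hHi : iIndepFun H P)
    (hXH : IndepFun (fun ω i => X i ω) (fun ω i => H i ω) P) {A : Set (ℝ × ℝ)}
    (hA : MeasurableSet A) :
    P {ω | ∀ i, (X i ω, H i ω) ∉ A} = expNeg (ENNReal.ofReal lam * (volume.prod ν) A) := by
  -- With `I = ∅` and `k = 0`, the conditioning event is everything.
  have h := hX.measure_inter_forall_notMem hlam hH hν hHi hXH MeasurableSet.empty 0 hA
    fun p _ => notMem_empty _
  have e : {ω | pointCount (fun i => X i ω) ∅ = (0 : ℕ)} = univ :=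
    eq_univ_of_forall fun ω => by simp [pointCount]
  rwa [e, univ_inter, measure_univ, one_mul] at h

theorem measurableSet_forall_notMem (hX : ∀ i, Measurable (X i)) (hH : ∀ i, Measurable (H i))
    {A : Set (ℝ × ℝ)} (hA : MeasurableSet A) : MeasurableSet {ω | ∀ i, (X i ω, H i ω) ∉ A} := by
  have e : {ω | ∀ i, (X i ω, H i ω) ∉ A} = ⋂ i, (fun ω => (X i ω, H i ω)) ⁻¹' Aᶜ := by
    ext ω; simp
  rw [e]
  exact MeasurableSet.iInter fun i => ((hX i).prodMk (hH i)) hA.compl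

theorem ae_forall_notMem (hX : ∀ i, Measurable (X i)) (hH : ∀ i, Measurable (H i))
    (hvoid : ∀ A : Set (ℝ × ℝ), MeasurableSet A →
      P {ω | ∀ i, (X i ω, H i ω) ∉ A} = expNeg (ENNReal.ofReal lam * (volume.prod ν) A))
    {A : Set (ℝ × ℝ)} (hA : MeasurableSet A) (h0 : (volume.prod ν) A = 0) :
    ∀ᵐ ω ∂P, ∀ i, (X i ω, H i ω) ∉ A := by
  refine (mem_ae_iff_prob_eq_one (measurableSet_forall_notMem hX hH hA)).2 ?_
  rw [hvoid A hA, h0, mul_zero, expNeg_zero]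

theorem ae_exists_mem {P : Measure Ω} (hlam : 0 < lam)
    (hvoid : ∀ A : Set (ℝ × ℝ), MeasurableSet A →
      P {ω | ∀ i, (X i ω, H i ω) ∉ A} = expNeg (ENNReal.ofReal lam * (volume.prod ν) A))
    {A : Set (ℝ × ℝ)} (hA : MeasurableSet A) (h0 : (volume.prod ν) A = ⊤) :
    ∀ᵐ ω ∂P, ∃ i, (X i ω, H i ω) ∈ A := by
  rw [ae_iff]
  push Not
  rw [hvoid A hA, h0, ENNReal.mul_top (by simpa using hlam), expNeg_top]

variable [IsProbabilityMeasure ν]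

theorem ae_forall_fst_ne (hX : ∀ i, Measurable (X i)) (hH : ∀ i, Measurable (H i))
    (hvoid : ∀ A : Set (ℝ × ℝ), MeasurableSet A →
      P {ω | ∀ i, (X i ω, H i ω) ∉ A} = expNeg (ENNReal.ofReal lam * (volume.prod ν) A))
    (α : ℝ) : ∀ᵐ ω ∂P, ∀ i, X i ω ≠ α := by
  filter_upwards [ae_forall_notMem hX hH hvoid ((measurableSet_singleton α).prod MeasurableSet.univ)
    (by simp [Measure.prod_prod])] with ω hω i hi
  exact hω i ⟨hi, mem_univ _⟩

theorem ae_forall_snd_le (hX : ∀ i, Measurable (X i)) (hH : ∀ i, Measurable (H i))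
    (hvoid : ∀ A : Set (ℝ × ℝ), MeasurableSet A →
      P {ω | ∀ i, (X i ω, H i ω) ∉ A} = expNeg (ENNReal.ofReal lam * (volume.prod ν) A))
    {β : ℝ} (hβ : ν (Ioi β) = 0) : ∀ᵐ ω ∂P, ∀ i, H i ω ≤ β := by
  filter_upwards [ae_forall_notMem hX hH hvoid (MeasurableSet.univ.prod (measurableSet_Ioi (a := β)))
    (by simp [Measure.prod_prod, hβ])] with ω hω i
  by_contra! h
  exact hω i ⟨mem_univ _, h⟩

theorem ae_exists_higher {P : Measure Ω} (hlam : 0 < lam)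
    (hvoid : ∀ A : Set (ℝ × ℝ), MeasurableSet A →
      P {ω | ∀ i, (X i ω, H i ω) ∉ A} = expNeg (ENNReal.ofReal lam * (volume.prod ν) A))
    (α : ℝ) {β : ℝ} (hβ : ν (Ioi β) ≠ 0) : ∀ᵐ ω ∂P, ∃ k, α < X k ω ∧ β < H k ω := by
  filter_upwards [ae_exists_mem hlam hvoid
    ((measurableSet_Ioi (a := α)).prod (measurableSet_Ioi (a := β)))
    (by rw [Measure.prod_prod, Real.volume_Ioi, ENNReal.top_mul hβ])] with ω hω
  exact hω

theorem measurable_relayLength_comp (hX : ∀ i, Measurable (X i)) (hH : ∀ i, Measurable (H i))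
    {J : Set ℝ} (hJ : MeasurableSet J) (α δ β : ℝ) :
    Measurable fun ω => relayLength J α δ β (fun i => X i ω) (fun i => H i ω) :=
  (measurable_relayLength hJ α δ).comp (measurable_const.prodMk
    ((measurable_pi_lambda _ hX).prodMk (measurable_pi_lambda _ hH)))

end AlmostSure

/-- The expected length of the zone of an added building, for a height below the supremum of the
support or at an atom there. -/
theorem IsPoissonBuildingProcess.lintegral_zoneLength_insert {Ω : Type*} [MeasurableSpace Ω]
    {P : Measure Ω} [IsProbabilityMeasure P] {lam : ℝ} (hlam : 0 < lam)
    {ν : Measure ℝ} [IsProbabilityMeasure ν] (hν : ν (Iio 0) = 0)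
    (hmean : Integrable (fun h : ℝ => h) ν) {L : Ω → Set (ℝ × ℝ)}
    (hL : IsPoissonBuildingProcess P lam ν L) (α : ℝ) {β : ℝ} (hβ : 0 ≤ β) :
    AEMeasurable (fun ω => zoneLength (insert (α, β) (L ω)) (α, β)) P ∧
    (ν (Ioi β) ≠ 0 → ∫⁻ ω, zoneLength (insert (α, β) (L ω)) (α, β) ∂P =
      (ENNReal.ofReal lam)⁻¹ * ∫⁻ u in Ioo 0 β, tailIntegral ν β / tailIntegral ν u ^ 2) ∧
    (ν (Ioi β) = 0 → ∫⁻ ω, zoneLength (insert (α, β) (L ω)) (α, β) ∂P = ⊤) := by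
  obtain ⟨X, H, hX, hH, hHν, hHi, hXH, hLeq⟩ := hL
  have hvoid : ∀ A : Set (ℝ × ℝ), MeasurableSet A →
      P {ω | ∀ i, (X i ω, H i ω) ∉ A} = expNeg (ENNReal.ofReal lam * (volume.prod ν) A) :=
    fun A hA => hX.measure_forall_notMem hlam hH hHν hHi hXH hA
  have hne := ae_forall_fst_ne hX.measurable hH hvoid α
  have hfin := hX.ae_finite hlam
  have hpos : ν (Ioi β) ≠ 0 → (fun ω => zoneLength (insert (α, β) (L ω)) (α, β)) =ᵐ[P]
      fun ω => relayLength univ α 0 β (fun i => X i ω) (fun i => H i ω) := by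
    intro h
    filter_upwards [hne, hfin, hLeq, ae_exists_higher hlam hvoid α h] with ω h1 h2 h3 h4
    rw [h3, zoneLength_eq_relayLength hβ h1 h2 h4]
  have hzero : ν (Ioi β) = 0 → (fun ω => zoneLength (insert (α, β) (L ω)) (α, β)) =ᵐ[P]
      fun _ => ⊤ := by
    intro h
    filter_upwards [hne, hfin, hLeq, ae_forall_snd_le hX.measurable hH hvoid h] with ω h1 h2 h3 h4
    rw [h3, ← top_le_iff, ← relayLength_eq_top (J := univ) (α := α) (δ := 0) h4]
    exact relayLength_le_zoneLength hβ h1 h2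
  refine ⟨?_, fun h => ?_, fun h => ?_⟩
  · by_cases h : ν (Ioi β) = 0
    · exact aemeasurable_const.congr (hzero h).symm
    · exact (measurable_relayLength_comp hX.measurable hH MeasurableSet.univ α 0
        β).aemeasurable.congr (hpos h).symm
  · rw [lintegral_congr_ae (hpos h)]
    exact lintegral_relayLength_univ hlam hX.measurable hH hvoid hβ (tailIntegral_ne_zero h)
      fun u hu => tailIntegral_ne_top hν hmean hu
  · rw [lintegral_congr_ae (hzero h)]
    simp

/-! ### The zone of the typical building -/

/-- With `J` the complement of [0, 1], this says that the relay length ignores the height of the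
building standing in [0, 1], which can therefore be integrated separately. -/
theorem relayLength_congr {J : Set ℝ} {α δ β : ℝ} {x h h' : ℕ → ℝ} (hαJ : Ioi α ⊆ J)
    (hh : ∀ j, x j ∈ J → h j = h' j) :
    relayLength J α δ β x h = relayLength J α δ β x h' := by
  have key : ∀ {h h' : ℕ → ℝ}, (∀ j, x j ∈ J → h j = h' j) → ∀ d,
      SequenceRelay J α β d x h → SequenceRelay J α β d x h' := by
    rintro h h' hh d ⟨hd, hle, hk⟩
    refine ⟨hd, fun j hj hj' hj'' => hh j hj ▸ hle j hj hj' hj'', fun k hkα hkβ => ?_⟩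
    have ek := hh k (hαJ hkα)
    rw [← ek] at hkβ ⊢
    refine ⟨(hk k hkα hkβ).1, fun j hj hj' hj'' => ?_⟩
    rw [← hh j hj]
    exact (hk k hkα hkβ).2 j hj hj' hj''
  unfold relayLength
  congr 1
  ext d
  exact and_congr_right fun _ => ⟨key hh d, key (fun j hj => (hh j hj).symm) d⟩

/-- Moving the building from 1 to `x i ≤ 1` shortens the distances to the left and lengthens those
to the right. As no other building stands in [0, 1], arriving slopes increase and the positive
leaving slopes decrease. The ground point stays at `1 - d`, now at distance `d - (1 - x i)`. -/
theorem SequenceRelay.relayCondition_shift {x h : ℕ → ℝ} {i : ℕ} (hi : x i ∈ Icc (0 : ℝ) 1)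
    (hj : ∀ j, j ≠ i → x j ∉ Icc (0 : ℝ) 1) (hi0 : 0 ≤ h i) {d : ℝ} (hd : 1 < d)
    (hr : SequenceRelay (Icc 0 1)ᶜ 1 (h i) d x h) :
    RelayCondition (shiftLandscape (x i) (range fun k => (x k, h k))) (0, h i)
      (0 - (d - (1 - x i)), 0) := by
  obtain ⟨-, hle, hk⟩ := hr
  have hx0 := hi.1
  have hx1 := hi.2
  refine ⟨by simp only [zero_sub]; linarith, ?_⟩
  rintro _ ⟨_, ⟨k, rfl⟩, rfl⟩ hc q hq hqb
  have hc : x i < x k := by simpa using hc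
  have hki : k ≠ i := fun e => lt_irrefl _ (e ▸ hc)
  have hk1 : 1 < x k := by
    by_contra! h
    exact hj k hki ⟨hx0.trans hc.le, h⟩
  simp only [zero_sub, sub_zero] at hq hqb ⊢
  have hq' : 0 < -q.1 := by linarith
  -- This is the condition for the building placed at 1, in coordinates centred at `x i`.
  suffices hs : q.2 ≤ h i ∧ (h i < h k →
      (h k - h i) * (1 - x i - q.1) ≤ (h i - q.2) * (x k - 1)) by
    rcases le_or_gt (h k) (h i) with hkβ | hkβ
    · exact (mul_nonpos_of_nonpos_of_nonneg (sub_nonpos.2 hkβ) hq'.le).trans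
        (mul_nonneg (sub_nonneg.2 hs.1) (by linarith))
    · have h1 := hs.2 hkβ
      have h2 : (h k - h i) * -q.1 ≤ (h k - h i) * (1 - x i - q.1) :=
        mul_le_mul_of_nonneg_left (by linarith) (sub_pos.2 hkβ).le
      have h3 : (h i - q.2) * (x k - 1) ≤ (h i - q.2) * (x k - x i) :=
        mul_le_mul_of_nonneg_left (by linarith) (sub_nonneg.2 hs.1)
      exact h2.trans (h1.trans h3)
  rcases hq with rfl | ⟨⟨_, ⟨j, rfl⟩, rfl⟩, hdq⟩
  · refine ⟨hi0, fun hkβ => ?_⟩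
    have h1 := (hk k hk1 hkβ).1
    simp only [sub_zero]
    convert h1 using 2
    ring
  · simp only at hqb hdq ⊢
    have hji : j ≠ i := fun e => by
      rw [e, sub_self] at hqb; exact lt_irrefl _ hqb
    have hjJ : x j ∈ (Icc (0 : ℝ) 1)ᶜ := hj j hji
    have hjd : 1 - d < x j := by linarith
    have hj1 : x j < 1 := by linarith
    refine ⟨hle j hjJ hjd hj1, fun hkβ => ?_⟩
    have h1 := (hk k hk1 hkβ).2 j hjJ hjd hj1
    convert h1 using 2
    ring

theorem relayLength_le_zoneLength_shift {x h : ℕ → ℝ} {i : ℕ} (hi : x i ∈ Icc (0 : ℝ) 1)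
    (hj : ∀ j, j ≠ i → x j ∉ Icc (0 : ℝ) 1) (hi0 : 0 ≤ h i)
    (hfin : ∀ n : ℕ, {i | x i ∈ Icc (-(n : ℝ)) n}.Finite) :
    relayLength (Icc 0 1)ᶜ 1 1 (h i) x h ≤
      zoneLength (shiftLandscape (x i) (range fun k => (x k, h k))) (0, h i) := by
  have hmem : ((0 : ℝ), h i) ∈ shiftLandscape (x i) (range fun k => (x k, h k)) :=
    ⟨(x i, h i), ⟨i, rfl⟩, by simp⟩
  rw [zoneLength_eq hmem hi0]
  · rw [relayLength, ← measure_preimage_add_right volume (1 - x i)]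
    refine measure_mono fun d hd => ?_
    have h1 := hd.2.relayCondition_shift hi hj hi0 hd.1
    rwa [add_sub_cancel_right] at h1
  · rintro _ ⟨_, ⟨j, rfl⟩, rfl⟩ hc
    have hc : x j = x i := by simpa [sub_eq_zero] using hc
    by_cases hji : j = i
    · rw [hji]; simp
    · exact absurd (hc ▸ hi) (hj j hji)
  · intro z
    obtain ⟨n, hn⟩ := exists_nat_ge (max (-(z + x i)) (x i))
    refine ((hfin n).image fun k => (x k - x i, h k)).subset ?_
    rintro _ ⟨⟨_, ⟨k, rfl⟩, rfl⟩, hz, hq⟩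
    simp only at hz hq
    refine ⟨k, ⟨?_, ?_⟩, rfl⟩
    · linarith [(le_max_left (-(z + x i)) (x i)).trans hn]
    · linarith [(le_max_right (-(z + x i)) (x i)).trans hn]

/-! ### Independence of the height of a single building. -/

section Palm

variable {Ω : Type*} [MeasurableSpace Ω] {P : Measure Ω} [IsProbabilityMeasure P] {lam : ℝ}
  {X H : ℕ → Ω → ℝ} {ν : Measure ℝ}

theorem indepFun_update {P : Measure Ω} (hH : ∀ i, Measurable (H i)) (hHi : iIndepFun H P) (i : ℕ) :
    IndepFun (H i) (fun ω => Function.update (fun j => H j ω) i 0) P := by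
  have h := indep_iSup_of_disjoint (m := fun j => MeasurableSpace.comap (H j) inferInstance)
    (fun j => (hH j).comap_le) hHi.iIndep (disjoint_compl_right (a := ({i} : Set ℕ)))
  refine indep_of_indep_of_le_left (indep_of_indep_of_le_right h ?_) ?_
  · rw [← measurable_iff_comap_le]
    refine @measurable_pi_lambda _ _ _ (_) _ _ fun j => ?_
    by_cases hj : j = i
    · subst hj
      simp only [Function.update_self]
      exact measurable_const
    · simp only [Function.update_of_ne hj]
      rw [measurable_iff_comap_le]
      exact le_iSup₂_of_le (f := fun j (_ : j ∈ ({i} : Set ℕ)ᶜ) =>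
        MeasurableSpace.comap (H j) inferInstance) j hj le_rfl
  · exact le_iSup₂_of_le (f := fun j (_ : j ∈ ({i} : Set ℕ)) =>
      MeasurableSpace.comap (H j) inferInstance) i rfl le_rfl

/-- As `Φ b h` does not see the entry `i` of `h`, that entry may be replaced by 0, which makes the
sequence independent of `H i`. -/
theorem lintegral_coordinate (hH : ∀ i, Measurable (H i)) (hν : ∀ i, P.map (H i) = ν)
    (hHi : iIndepFun H P) (i : ℕ) {Φ : ℝ → (ℕ → ℝ) → ENNReal}
    (hΦ : Measurable fun p : ℝ × (ℕ → ℝ) => Φ p.1 p.2)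
    (hΦi : ∀ b h h', (∀ j, j ≠ i → h j = h' j) → Φ b h = Φ b h') :
    ∫⁻ ω, Φ (H i ω) (fun j => H j ω) ∂P = ∫⁻ b, ∫⁻ ω, Φ b (fun j => H j ω) ∂P ∂ν := by
  have hHm : Measurable fun ω => Function.update (fun j => H j ω) i 0 := by
    refine measurable_pi_lambda _ fun j => ?_
    by_cases hj : j = i
    · subst hj; simp
    · simpa [Function.update_of_ne hj] using hH j
  have e : ∀ b ω, Φ b (fun j => H j ω) = Φ b (Function.update (fun j => H j ω) i 0) :=
    fun b ω => hΦi b _ _ fun j hj => (Function.update_of_ne hj 0 fun j => H j ω).symm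
  simp only [e]
  have h1 := (indepFun_iff_map_prod_eq_prod_map_map (hH i).aemeasurable hHm.aemeasurable).1
    (indepFun_update hH hHi i)
  have h2 : ∫⁻ ω, Φ (H i ω) (Function.update (fun j => H j ω) i 0) ∂P =
      ∫⁻ p, Φ p.1 p.2 ∂(P.map fun ω => (H i ω, Function.update (fun j => H j ω) i 0)) :=
    (lintegral_map hΦ ((hH i).prodMk hHm)).symm
  rw [h2, h1, lintegral_prod _ hΦ.aemeasurable, hν i]
  refine lintegral_congr fun b => ?_
  exact lintegral_map (hΦ.comp measurable_prodMk_left) hHm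

theorem lintegral_sequences (hX : ∀ i, Measurable (X i)) (hH : ∀ i, Measurable (H i))
    (hXH : IndepFun (fun ω i => X i ω) (fun ω i => H i ω) P)
    {F : (ℕ → ℝ) → (ℕ → ℝ) → ENNReal}
    (hF : Measurable fun p : (ℕ → ℝ) × (ℕ → ℝ) => F p.1 p.2) :
    ∫⁻ ω, F (fun i => X i ω) (fun i => H i ω) ∂P =
      ∫⁻ ω, ∫⁻ ω', F (fun i => X i ω) (fun i => H i ω') ∂P ∂P := by
  have hXm : Measurable fun ω i => X i ω := measurable_pi_lambda _ hX
  have hHm : Measurable fun ω i => H i ω := measurable_pi_lambda _ hH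
  have h2 : ∫⁻ ω, F (fun i => X i ω) (fun i => H i ω) ∂P =
      ∫⁻ p, F p.1 p.2 ∂(P.map fun ω => ((fun i => X i ω), fun i => H i ω)) :=
    (lintegral_map hF (hXm.prodMk hHm)).symm
  rw [h2, map_sequences_eq_prod hX hH hXH, lintegral_prod _ hF.aemeasurable,
    lintegral_map hF.lintegral_prod_right' hXm]
  refine lintegral_congr fun ω => ?_
  exact lintegral_map (hF.comp measurable_prodMk_left) hHm

/-- Given that there is a single building in `I`, its height is independent of the other
buildings. -/
theorem lintegral_single_building (hX : ∀ i, Measurable (X i)) (hH : ∀ i, Measurable (H i))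
    (hν : ∀ i, P.map (H i) = ν) (hHi : iIndepFun H P)
    (hXH : IndepFun (fun ω i => X i ω) (fun ω i => H i ω) P)
    {I : Set ℝ} (hI : MeasurableSet I) {Ψ : ℝ → (ℕ → ℝ) → (ℕ → ℝ) → ENNReal}
    (hΨ : Measurable fun p : ℝ × ((ℕ → ℝ) × (ℕ → ℝ)) => Ψ p.1 p.2.1 p.2.2)
    (hΨI : ∀ b x h h', (∀ j, x j ∉ I → h j = h' j) → Ψ b x h = Ψ b x h') :
    ∫⁻ ω, {x : ℕ → ℝ | pointCount x I = (1 : ℕ)}.indicator 1 (fun i => X i ω) *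
        ∑' i, I.indicator 1 (X i ω) * Ψ (H i ω) (fun i => X i ω) (fun i => H i ω) ∂P =
      ∫⁻ b, ∫⁻ ω in {ω | pointCount (fun i => X i ω) I = (1 : ℕ)},
        Ψ b (fun i => X i ω) (fun i => H i ω) ∂P ∂ν := by
  have hPν : IsProbabilityMeasure ν :=
    hν 0 ▸ Measure.isProbabilityMeasure_map (hH 0).aemeasurable
  set C : Set (ℕ → ℝ) := {x | pointCount x I = (1 : ℕ)} with hCdef
  have hC : MeasurableSet C := measurableSet_pointCount_eq hI 1
  have hXm : Measurable fun ω i => X i ω := measurable_pi_lambda _ hX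
  have hHm : Measurable fun ω i => H i ω := measurable_pi_lambda _ hH
  have hind : ∀ {g : (ℕ → ℝ) × (ℕ → ℝ) → ℕ → ℝ}, Measurable g →
      Measurable fun p => C.indicator (1 : (ℕ → ℝ) → ENNReal) (g p) :=
    fun hg => (measurable_one.indicator hC).comp hg
  have hΨi : ∀ i, Measurable fun p : (ℕ → ℝ) × (ℕ → ℝ) => Ψ (p.2 i) p.1 p.2 := by
    intro i
    have hφ : Measurable fun p : (ℕ → ℝ) × (ℕ → ℝ) => (p.2 i, p) :=
      ((measurable_pi_apply i).comp measurable_snd).prodMk measurable_id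
    exact hΨ.comp hφ
  have hIi : ∀ i, Measurable fun p : (ℕ → ℝ) × (ℕ → ℝ) =>
      I.indicator (1 : ℝ → ENNReal) (p.1 i) := fun i =>
    (measurable_one.indicator hI).comp ((measurable_pi_apply i).comp measurable_fst)
  have hF : Measurable fun p : (ℕ → ℝ) × (ℕ → ℝ) => C.indicator 1 p.1 *
      ∑' i, I.indicator 1 (p.1 i) * Ψ (p.2 i) p.1 p.2 :=
    (hind measurable_fst).mul (Measurable.tsum fun i => (hIi i).mul (hΨi i))
  have hb : ∀ b, Measurable fun p : (ℕ → ℝ) × (ℕ → ℝ) => C.indicator 1 p.1 * Ψ b p.1 p.2 :=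
    fun b => (hind measurable_fst).mul (hΨ.comp measurable_prodMk_left)
  rw [lintegral_sequences hX hH hXH
    (F := fun x h => C.indicator 1 x * ∑' i, I.indicator 1 (x i) * Ψ (h i) x h) hF]
  -- For fixed positions, each index standing in `I` contributes the same integral, and there is
  -- exactly one such index.
  have hinner : ∀ x : ℕ → ℝ, ∫⁻ ω, C.indicator 1 x *
      ∑' i, I.indicator 1 (x i) * Ψ (H i ω) x (fun i => H i ω) ∂P =
      ∫⁻ b, ∫⁻ ω, C.indicator 1 x * Ψ b x (fun i => H i ω) ∂P ∂ν := by
    intro x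
    by_cases hx : x ∈ C
    · simp only [indicator_of_mem hx, Pi.one_apply, one_mul]
      have hm : ∀ i, Measurable fun ω => Ψ (H i ω) x (fun i => H i ω) := fun i =>
        hΨ.comp ((hH i).prodMk (measurable_const.prodMk hHm))
      have hne : ∀ i, I.indicator (1 : ℝ → ENNReal) (x i) ≠ ⊤ := fun i =>
        ((indicator_le_self' (fun _ _ => zero_le) (x i)).trans_lt ENNReal.one_lt_top).ne
      rw [lintegral_tsum fun i => ((hm i).const_mul _).aemeasurable]
      have hterm : ∀ i, ∫⁻ ω, I.indicator 1 (x i) * Ψ (H i ω) x (fun i => H i ω) ∂P =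
          I.indicator 1 (x i) * ∫⁻ b, ∫⁻ ω, Ψ b x (fun i => H i ω) ∂P ∂ν := by
        intro i
        rw [lintegral_const_mul' _ _ (hne i)]
        by_cases hi : x i ∈ I
        · rw [lintegral_coordinate hH hν hHi i (Φ := fun b h => Ψ b x h)]
          · exact hΨ.comp (measurable_fst.prodMk (measurable_const.prodMk measurable_snd))
          · intro b h h' hh
            exact hΨI b x h h' fun j hj => hh j fun e => hj (e ▸ hi)
        · rw [indicator_of_notMem hi, zero_mul, zero_mul]
      have hx : pointCount x I = (1 : ℕ) := hx
      rw [tsum_congr hterm, ENNReal.tsum_mul_right, tsum_indicator_eq_pointCount, hx]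
      simp
    · simp only [indicator_of_notMem hx, zero_mul, lintegral_zero]
  simp only [hinner]
  have hm2 : Measurable fun p : Ω × ℝ => ∫⁻ ω', C.indicator 1 (fun i => X i p.1) *
      Ψ p.2 (fun i => X i p.1) (fun i => H i ω') ∂P := by
    have : Measurable fun q : (Ω × ℝ) × Ω => C.indicator (1 : (ℕ → ℝ) → ENNReal)
        (fun i => X i q.1.1) * Ψ q.1.2 (fun i => X i q.1.1) (fun i => H i q.2) := by
      refine Measurable.mul ?_ ?_
      · exact (measurable_one.indicator hC).comp (hXm.comp (measurable_fst.comp measurable_fst))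
      · exact hΨ.comp ((measurable_snd.comp measurable_fst).prodMk
          ((hXm.comp (measurable_fst.comp measurable_fst)).prodMk (hHm.comp measurable_snd)))
    exact this.lintegral_prod_right'
  rw [lintegral_lintegral_swap hm2.aemeasurable]
  refine lintegral_congr fun b => ?_
  rw [← lintegral_sequences hX hH hXH (F := fun x h => C.indicator 1 x * Ψ b x h) (hb b)]
  have hC' : MeasurableSet {ω | pointCount (fun i => X i ω) I = (1 : ℕ)} := hXm hC
  rw [← lintegral_indicator hC']
  refine lintegral_congr fun ω => ?_
  by_cases hω : (fun i => X i ω) ∈ C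
  · rw [indicator_of_mem hω, Pi.one_apply, one_mul, indicator_of_mem (by exact hω)]
  · rw [indicator_of_notMem hω, zero_mul, indicator_of_notMem (by exact hω)]

end Palm

/-- Conditioning on the number of buildings in [0, 1] leaves the void probabilities elsewhere
unchanged, so the lower bound on the mean length applies at every height that can be exceeded. -/
theorem lintegral_single_relayLength_eq_top {Ω : Type*} [MeasurableSpace Ω] {P : Measure Ω}
    [IsProbabilityMeasure P] {lam : ℝ} (hlam : 0 < lam) {ν : Measure ℝ} [IsProbabilityMeasure ν]
    (hν : ν (Iio 0) = 0) (hmean : Integrable (fun h : ℝ => h) ν) {X H : ℕ → Ω → ℝ}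
    (hX : IsPoissonPointProcess P lam X) (hH : ∀ i, Measurable (H i))
    (hHν : ∀ i, P.map (H i) = ν) (hHi : iIndepFun H P)
    (hXH : IndepFun (fun ω i => X i ω) (fun ω i => H i ω) P) :
    ∫⁻ b, ∫⁻ ω in {ω | pointCount (fun i => X i ω) (Icc 0 1) = (1 : ℕ)},
      relayLength (Icc 0 1)ᶜ 1 1 b (fun i => X i ω) (fun i => H i ω) ∂P ∂ν = ⊤ := by
  set C : Set Ω := {ω | pointCount (fun i => X i ω) (Icc 0 1) = (1 : ℕ)}
  have hI : MeasurableSet (Icc (0 : ℝ) 1) := measurableSet_Icc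
  have hC : MeasurableSet C :=
    measurable_pointCount hX.measurable hI (measurableSet_singleton _)
  have hPC : P C ≠ 0 := by
    have h := hX.count_law (Icc 0 1) hI (by simp) 1
    have h2 : P C = _ := h
    rw [h2]
    simp [Real.exp_pos, hlam]
  have hPC' : P C ≠ ⊤ := measure_ne_top _ _
  let Q : Measure Ω := ProbabilityTheory.cond P C
  have hQ : IsProbabilityMeasure Q := cond_isProbabilityMeasure hPC
  have hrestr : ∀ f : Ω → ENNReal, ∫⁻ ω in C, f ω ∂P = P C * ∫⁻ ω, f ω ∂Q := by
    intro f
    rw [show Q = (P C)⁻¹ • P.restrict C from rfl, lintegral_smul_measure, smul_eq_mul, ← mul_assoc,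
      ENNReal.mul_inv_cancel hPC hPC', one_mul]
  simp only [hrestr]
  rw [lintegral_const_mul' _ _ hPC']
  refine ENNReal.mul_eq_top.2 (Or.inl ⟨hPC, ?_⟩)
  have hvoidQ : ∀ A : Set (ℝ × ℝ), MeasurableSet A → (∀ p ∈ A, p.1 ∈ (Icc (0 : ℝ) 1)ᶜ) →
      Q {ω | ∀ i, (X i ω, H i ω) ∉ A} = expNeg (ENNReal.ofReal lam * (volume.prod ν) A) := by
    intro A hA hAI
    rw [cond_apply hC, hX.measure_inter_forall_notMem hlam hH hHν hHi hXH hI 1 hA hAI, ← mul_assoc,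
      ENNReal.inv_mul_cancel hPC hPC', one_mul]
  -- Either almost every height can be exceeded, and the mean length formula diverges, or `ν`
  -- charges heights that are almost surely not exceeded, where the length is already infinite.
  by_cases hW : ∀ᵐ h ∂ν, ν (Ioi h) ≠ 0
  · have hG : ∀ u, 0 ≤ u → tailIntegral ν u ≠ ⊤ := fun u hu => tailIntegral_ne_top hν hmean hu
    have htop := tailMeanLength_zero_eq_top hν hG hW
    -- The term 1 pays for the discarded distances `d ≤ 1`.
    have h1 : (ENNReal.ofReal lam)⁻¹ * tailMeanLength ν 0 ≤ 1 + ∫⁻ b, ∫⁻ ω,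
        relayLength (Icc 0 1)ᶜ 1 1 b (fun i => X i ω) (fun i => H i ω) ∂Q ∂ν := by
      rw [tailMeanLength, ← lintegral_const_mul' _ _ (ENNReal.inv_ne_top.2 (by simpa using hlam))]
      have h2 : (1 : ENNReal) = ∫⁻ _, 1 ∂ν := by simp
      rw [h2, ← lintegral_add_left measurable_const]
      refine le_trans ?_ (setLIntegral_le_lintegral (Ioi 0) _)
      refine lintegral_mono_ae ?_
      filter_upwards [ae_restrict_of_ae hW, ae_restrict_mem measurableSet_Ioi] with b hb hb0
      have h3 := le_lintegral_relayLength (Q := Q) (α := 1) hlam hX.measurable hH hI.compl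
        (fun x hx hx' => not_lt.2 hx'.2 hx) hvoidQ (le_of_lt hb0) (tailIntegral_ne_zero hb) hG
        zero_le_one
      rwa [ENNReal.ofReal_one] at h3
    rw [htop, ENNReal.mul_top (by simp)] at h1
    exact (ENNReal.add_eq_top.1 (top_le_iff.1 h1)).resolve_left ENNReal.one_ne_top
  · have hWm : MeasurableSet {b | ν (Ioi b) = 0} :=
      measurable_measure_Ioi (measurableSet_singleton 0)
    have hW0 : ν {b | ν (Ioi b) = 0} ≠ 0 := by
      rw [ae_iff] at hW
      simpa only [not_not] using hW
    have hvoid : ∀ A : Set (ℝ × ℝ), MeasurableSet A →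
        P {ω | ∀ i, (X i ω, H i ω) ∉ A} = expNeg (ENNReal.ofReal lam * (volume.prod ν) A) :=
      fun A hA => hX.measure_forall_notMem hlam hH hHν hHi hXH hA
    have h1 : ∀ b ∈ {b | ν (Ioi b) = 0}, ∫⁻ ω,
        relayLength (Icc 0 1)ᶜ 1 1 b (fun i => X i ω) (fun i => H i ω) ∂Q = ⊤ := by
      intro b hb
      have h2 : ∀ᵐ ω ∂Q, relayLength (Icc 0 1)ᶜ 1 1 b (fun i => X i ω) (fun i => H i ω) = ⊤ := by
        filter_upwards [cond_absolutelyContinuous.ae_le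
          (ae_forall_snd_le hX.measurable hH hvoid hb)] with ω hω
        exact relayLength_eq_top hω
      rw [lintegral_congr_ae h2]
      simp
    refine top_le_iff.1 (le_trans ?_ (setLIntegral_le_lintegral {b | ν (Ioi b) = 0} _))
    rw [setLIntegral_congr_fun hWm h1, setLIntegral_const, ENNReal.top_mul hW0]

/-- Under the Palm measure, the expected length of the zone of the typical building is infinite. -/
theorem IsPoissonBuildingProcess.palmExpectation_zoneLength {Ω : Type*} [MeasurableSpace Ω]
    {P : Measure Ω} [IsProbabilityMeasure P] {lam : ℝ} (hlam : 0 < lam)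
    {ν : Measure ℝ} [IsProbabilityMeasure ν] (hν : ν (Iio 0) = 0)
    (hmean : Integrable (fun h : ℝ => h) ν) {L : Ω → Set (ℝ × ℝ)}
    (hL : IsPoissonBuildingProcess P lam ν L) :
    palmExpectation P lam L (fun h 𝓁 => zoneLength 𝓁 (0, h)) = ⊤ := by
  obtain ⟨X, H, hX, hH, hHν, hHi, hXH, hLeq⟩ := hL
  have hvoid : ∀ A : Set (ℝ × ℝ), MeasurableSet A →
      P {ω | ∀ i, (X i ω, H i ω) ∉ A} = expNeg (ENNReal.ofReal lam * (volume.prod ν) A) :=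
    fun A hA => hX.measure_forall_notMem hlam hH hHν hHi hXH hA
  have hI : MeasurableSet (Icc (0 : ℝ) 1) := measurableSet_Icc
  have hIoi : Ioi (1 : ℝ) ⊆ (Icc (0 : ℝ) 1)ᶜ := fun x hx hx' => not_lt.2 hx'.2 hx
  have htop := lintegral_single_relayLength_eq_top hlam hν hmean hX hH hHν hHi hXH
  rw [← lintegral_single_building hX.measurable hH hHν hHi hXH hI
    (measurable_relayLength hI.compl 1 1) fun b x h h' hh => relayLength_congr hIoi hh] at htop
  rw [palmExpectation]
  refine ENNReal.mul_eq_top.2 (Or.inl ⟨by simp, ?_⟩)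
  -- The Palm sum is bounded below by its single term on the event that [0, 1] contains one
  -- building, and by 0 elsewhere.
  refine top_le_iff.1 (htop.symm.le.trans (lintegral_mono_ae ?_))
  have hH0 : ∀ᵐ ω ∂P, ∀ i, (X i ω, H i ω) ∉ univ ×ˢ Iio (0 : ℝ) :=
    ae_forall_notMem hX.measurable hH hvoid (MeasurableSet.univ.prod measurableSet_Iio)
      (by simp [Measure.prod_prod, hν])
  -- Almost surely no building stands at 1, which reconciles the closed interval of the conditioning
  -- with the half-open one of the Palm sum.
  filter_upwards [hH0, hX.ae_finite hlam, hLeq, ae_forall_fst_ne hX.measurable hH hvoid 1]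
    with ω h0 hfin hLω hne1
  by_cases hω : pointCount (fun i => X i ω) (Icc 0 1) = (1 : ℕ)
  · rw [indicator_of_mem (by exact hω), Pi.one_apply, one_mul]
    rw [pointCount, Nat.cast_one, encard_eq_one] at hω
    obtain ⟨i, hi⟩ := hω
    have hiI : X i ω ∈ Icc (0 : ℝ) 1 := by
      have : i ∈ {i | X i ω ∈ Icc (0 : ℝ) 1} := hi ▸ mem_singleton i
      exact this
    have hjI : ∀ j, j ≠ i → X j ω ∉ Icc (0 : ℝ) 1 := fun j hj h => by
      have : j ∈ {i | X i ω ∈ Icc (0 : ℝ) 1} := h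
      rw [hi] at this
      exact hj this
    have hi0 : 0 ≤ H i ω := by
      by_contra! h
      exact h0 i ⟨mem_univ _, h⟩
    rw [tsum_eq_single i fun j hj => by rw [indicator_of_notMem (hjI j hj), zero_mul],
      indicator_of_mem hiI, Pi.one_apply, one_mul]
    refine (relayLength_le_zoneLength_shift (x := fun i => X i ω) (h := fun i => H i ω) hiI hjI hi0
      hfin).trans ?_
    rw [hLω]
    exact ENNReal.le_tsum (f := fun b : {b : ℝ × ℝ // b ∈ range (fun i => (X i ω, H i ω)) ∧
      b.1 ∈ Ico (0 : ℝ) 1} => zoneLength (shiftLandscape b.1.1 (range fun i => (X i ω, H i ω)))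
        (0, b.1.2)) ⟨(X i ω, H i ω), ⟨i, rfl⟩, hiI.1, lt_of_le_of_ne hiI.2 (hne1 i)⟩
  · rw [indicator_of_notMem (by exact hω), zero_mul]
    exact zero_le

theorem mainTheorem9 {Ω : Type*} [MeasurableSpace Ω] (P : Measure Ω) [IsProbabilityMeasure P]
    (lam : ℝ) (hlam : 0 < lam)
    (ν : Measure ℝ) [IsProbabilityMeasure ν] (hν : ν (Iio 0) = 0)
    (hmean : Integrable (fun h : ℝ => h) ν)
    (L : Ω → Set (ℝ × ℝ)) (hL : IsPoissonBuildingProcess P lam ν L) :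
    (∀ α β : ℝ, 0 ≤ β → 0 < ν (Ici β) →
      AEMeasurable (fun ω => zoneLength (insert (α, β) (L ω)) (α, β)) P ∧
      ((β : EReal) < heightSup ν →
        IntervalIntegrable (fun u => -(1 / lam) * (tailPrimitive ν β / tailPrimitive ν u ^ 2))
          volume 0 β ∧
        ∫⁻ ω, zoneLength (insert (α, β) (L ω)) (α, β) ∂P =
          ENNReal.ofReal
            (∫ u in (0 : ℝ)..β, -(1 / lam) * (tailPrimitive ν β / tailPrimitive ν u ^ 2))) ∧
      ((β : EReal) = heightSup ν →
        ∫⁻ ω, zoneLength (insert (α, β) (L ω)) (α, β) ∂P = ⊤)) ∧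
    palmExpectation P lam L (fun h 𝓁 => zoneLength 𝓁 (0, h)) = ⊤ := by
  refine ⟨fun α β hβ _ => ?_, hL.palmExpectation_zoneLength hlam hν hmean⟩
  obtain ⟨hm, hlt, heq⟩ := hL.lintegral_zoneLength_insert hlam hν hmean α hβ
  refine ⟨hm, fun h => ?_, fun h => heq (measure_Ioi_eq_zero_of_heightSup_le h.ge)⟩
  have hβ0 := measure_Ioi_ne_zero_of_lt_heightSup h
  obtain ⟨h1, h2⟩ := intervalIntegrable_tailPrimitive_ratio
    (fun u hu => tailIntegral_ne_top hν hmean hu) hlam hβ (tailIntegral_ne_zero hβ0)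
  exact ⟨h1, (hlt hβ0).trans h2.symm⟩
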